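/- **Definitions.** Let $d,k\ge 1$ and let $\mathbf 1\in\mathbb R^k$ be the vector all of whose entries are $1/\sqrt k$. A *random binary direction* is $u=U\mathbf 1\in\mathbb R^d$, where $U$ is a uniformly random $d\times k$ matrix with entries $\pm1$. For $0\le\rho\le 1$, a *$\rho$-correlated copy* of $U$ is the random matrix $\hat U$ obtained by independently keeping each entry of $U$ with probability $\rho$ and replacing it by a fresh uniform $\pm1$ with probability $1-\rho$. Let $v_1,\dots,v_n\in\mathbb R^d$. A (binary) *$(\sigma,\delta)$-matching-cover* for $\{v_x\}$ is a family $\{M(u)\}_{u\in\mathbb R^d}$ of directed matchings on $\{1,\dots,n\}$ (sets of directed edges, no two sharing a vertex) such that $(v_y-v_x)\cdot u\ge\sigma$ for all $(x,y)\in M(u)$; $(x,y)\in M(u)$ iff $(y,x)\in M(-u)$; and $\mathbf E_u|M(u)|\ge\delta n$ for a random binary direction $u$. For a list $u_1,\dots,u_r$, let $M(u_1,\dots,u_r)$ be the directed graph with an edge $(x,y)$ iff there are $x=x_0,x_1,\dots,x_r=y$ with $(x_{i-1},x_i)\in M(u_i)$ for all $i\le r$. For integers $R\ge1$, $K\ge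 1$ and $\rho=1-1/K$, the procedure $\mathtt{Sample}_{d,k}(R,\rho)$ draws matrices $U_1,\dots,U_R$, where $U_1$ is uniform and $U_{i+1}$ is a $\rho$-correlated copy of $U_i$, and independent uniform matrices $W_1,\dots,W_R$ (all $d\times k$ with entries $\pm1$); takes a uniformly random order-preserving interleaving of the two lists; and outputs the directions $U\mathbf 1$ of the first $r$ matrices of the result, with $r$ uniform in $\{1,\dots,R\}$. Its *cost* is the worst-case total cost of its elementary random draws, where a uniform draw from a set of $m$ elements is charged $m$. **Lemma.** There are absolute constants $A,B>0$ such that for all $\sigma>0$ and $0<\delta<1$ there are constants $a,b,C>0$, depending only on $\sigma$ and $\delta$, with the following property. For all integers $n$ and $R$ with $1\le R\le a\sqrt{\log n}$ there are a real number $L\ge b\,R^2/\log n$, an integer $k_0\ge 0$ with $$k_0\le A\,R^2\log(1/\delta)\quad\text{and}\quad k_0\le B\log n,$$ and integers $1\le R'\le R$, $1\le K\le R$ such that for every dimension $d$ and every $k\ge\max(k_0,1)$ the distribution $\mathcal D$ of the output of $\mathtt{Sample}_{d,k}(R',1-1/K)$ satisfies: * $\mathcal D$ is a distribution over lists of at most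 $R$ vectors of $\mathbb R^d$, and its sampling cost is at most $20R^2(dk+1)$; * for all $v_1,\dots,v_n\in\mathbb R^d$ and every binary $(\sigma,\delta)$-matching-cover $M$ for $\{v_x\}$, the expected number of edges $(x,y)$ of $M(u_1,\dots,u_r)$ with $\|v_x-v_y\|^2\ge L$, where $(u_1,\dots,u_r)\sim\mathcal D$, is at least $e^{-CR^2}n$. -/

import Mathlib

open scoped ENNReal

/-- A program that makes finitely many random draws and then returns a value:
`draw m next` draws `i` uniformly from the `m + 1` elements of `Fin (m + 1)`, afresh and
independently of all earlier draws, and goes on with `next i`. -/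
inductive RandProg (α : Type) : Type
  | ret (a : α) : RandProg α
  | draw (m : ℕ) (next : Fin (m + 1) → RandProg α) : RandProg α

namespace RandProg

/-- Sequential composition. -/
def bind {α β : Type} : RandProg α → (α → RandProg β) → RandProg β
  | ret a, f => f a
  | draw m next, f => draw m fun i => (next i).bind f

/-- Apply a function to the returned value. -/
def map {α β : Type} (f : α → β) (p : RandProg α) : RandProg β :=
  p.bind fun a => ret (f a)

/-- The distribution of the returned value. -/
noncomputable def law {α : Type} : RandProg α → PMF α
  | ret a => PMF.pure a
  | draw m next => (PMF.uniformOfFintype (Fin (m + 1))).bind fun i => (next i).law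

/-- The worst-case cost of the random draws, where a draw from a set of `m + 1` elements is
charged `m + 1`. -/
def cost {α : Type} : RandProg α → ℕ
  | ret _ => 0
  | draw m next => (m + 1) + Finset.univ.sup fun i => (next i).cost

/-- Run the programs `p 0, …, p (n - 1)` one after the other, with independent draws, and return
the tuple of their results. -/
def tuple {α : Type} : (n : ℕ) → (Fin n → RandProg α) → RandProg (Fin n → α)
  | 0, _ => ret fun i => i.elim0
  | n + 1, p => (p 0).bind fun a => (tuple n fun i => p i.succ).map fun t => Fin.cons a t

/-- A uniformly random order-preserving interleaving of two lists: the next element comes from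
either list with probability proportional to the number of elements that this list has left. -/
def shuffle {α : Type} : List α → List α → RandProg (List α)
  | [], ws => ret ws
  | us, [] => ret us
  | u :: us, w :: ws =>
    draw (us.length + ws.length + 1) fun i =>
      if i.val < us.length + 1 then (shuffle us (w :: ws)).map fun l => u :: l
      else (shuffle (u :: us) ws).map fun l => w :: l
  termination_by us ws => us.length + ws.length

end RandProg

/-- `d × k` matrices with entries `±1`. -/
abbrev SignMatrix (d k : ℕ) : Type := Matrix (Fin d) (Fin k) ℤˣ

/-- The vector `U 𝟙 ∈ ℝ^d`, where all `k` entries of `𝟙` are `1 / √k`. -/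
noncomputable def direction {d k : ℕ} (U : SignMatrix d k) : EuclideanSpace ℝ (Fin d) :=
  WithLp.toLp 2 ((U.map fun s => ((s : ℤ) : ℝ)).mulVec fun _ => 1 / √(k : ℝ))

/-- The distribution of `U 𝟙` for a uniformly random sign matrix `U`. -/
noncomputable def directionLaw (d k : ℕ) : PMF (EuclideanSpace ℝ (Fin d)) :=
  (PMF.uniformOfFintype (SignMatrix d k)).map direction

/-- A fair random sign. -/
def randomSign : RandProg ℤˣ :=
  .draw 1 fun i => .ret (if i = 0 then 1 else -1)

/-- A sign matrix with independent fair random entries. -/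
def randomMatrix (d k : ℕ) : RandProg (SignMatrix d k) :=
  (RandProg.tuple d fun _ => RandProg.tuple k fun _ => randomSign).map Matrix.of

/-- A `ρ`-correlated copy of the sign `s`, where `ρ = 1 - 1 / K` and `K ≥ 1`: with probability
`1 / K` it is replaced by a fresh random sign, otherwise it is kept. -/
def correlatedSign (K : ℕ) (s : ℤˣ) : RandProg ℤˣ :=
  .draw (K - 1) fun i => if i = 0 then randomSign else .ret s

/-- A `ρ`-correlated copy of the matrix `U`, where `ρ = 1 - 1 / K`: each entry is rerandomized
independently with probability `1 - ρ = 1 / K`. -/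
def correlatedCopy {d k : ℕ} (K : ℕ) (U : SignMatrix d k) : RandProg (SignMatrix d k) :=
  (RandProg.tuple d fun i => RandProg.tuple k fun j => correlatedSign K (U i j)).map Matrix.of

/-- `U₁, …, U_m`, where `U₁` is a correlated copy of `U` and `U_{r+1}` is one of `U_r`. -/
def correlatedTail {d k : ℕ} (K : ℕ) : ℕ → SignMatrix d k → RandProg (List (SignMatrix d k))
  | 0, _ => .ret []
  | m + 1, U => (correlatedCopy K U).bind fun V => (correlatedTail K m V).map fun l => V :: l

/-- `U₁, …, U_R`, where `U₁` is uniformly random and `U_{r+1}` is a `(1 - 1 / K)`-correlated copy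
of `U_r`. For `K = 1` the matrices are independent. -/
def correlatedList (d k K : ℕ) : ℕ → RandProg (List (SignMatrix d k))
  | 0 => .ret []
  | m + 1 => (randomMatrix d k).bind fun U => (correlatedTail K m U).map fun l => U :: l

/-- The sampling procedure, for `R ≥ 1`: shuffle a list of `R` successively
`(1 - 1 / K)`-correlated matrices with a list of `R` independent ones, keep the first `r` matrices
of the result for a random `r ∈ {1, …, R}`, and return their directions. -/
noncomputable def sample (d k R K : ℕ) : RandProg (List (EuclideanSpace ℝ (Fin d))) :=
  (correlatedList d k K R).bind fun us =>
    (correlatedList d k 1 R).bind fun ws =>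
      (RandProg.shuffle us ws).bind fun l =>
        .draw (R - 1) fun i => .ret ((l.take (i.val + 1)).map direction)

/-- The expectation of a nonnegative function under a discrete distribution. -/
noncomputable def expectation {α : Type} (p : PMF α) (f : α → ℝ≥0∞) : ℝ≥0∞ :=
  ∑' a, p a * f a

/-- A directed matching: a set of directed edges, no two of which share a vertex. -/
def IsDirectedMatching {n : ℕ} (E : Finset (Fin n × Fin n)) : Prop :=
  (∀ e ∈ E, e.1 ≠ e.2) ∧
    ∀ e ∈ E, ∀ f ∈ E, e ≠ f → e.1 ≠ f.1 ∧ e.1 ≠ f.2 ∧ e.2 ≠ f.1 ∧ e.2 ≠ f.2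

/-- `M` is a `(σ, δ)`-matching-cover for the embedding `v`, with respect to the distribution `μ` of
a random direction. -/
structure IsMatchingCover {n d : ℕ} (μ : PMF (EuclideanSpace ℝ (Fin d))) (σ δ : ℝ)
    (v : Fin n → EuclideanSpace ℝ (Fin d))
    (M : EuclideanSpace ℝ (Fin d) → Finset (Fin n × Fin n)) : Prop where
  matching : ∀ u, IsDirectedMatching (M u)
  stretch : ∀ u x y, (x, y) ∈ M u → σ ≤ inner ℝ (v y - v x) u
  skew : ∀ u x y, (x, y) ∈ M u ↔ (y, x) ∈ M (-u)
  large : ENNReal.ofReal (δ * n) ≤ expectation μ fun u => ((M u).card : ℝ≥0∞)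

/-- `(x, y)` is an edge of `M(u₁, …, u_r)`: there are `x = x₀, x₁, …, x_r = y` with
`(x_{i-1}, x_i) ∈ M(u_i)` for all `i`. -/
def ChainEdge {n d : ℕ} (M : EuclideanSpace ℝ (Fin d) → Finset (Fin n × Fin n)) :
    List (EuclideanSpace ℝ (Fin d)) → Fin n → Fin n → Prop
  | [], x, y => x = y
  | u :: us, x, y => ∃ z, (x, z) ∈ M u ∧ ChainEdge M us z y

/-- The number of edges `(x, y)` of `M(u₁, …, u_r)` with `‖v_x - v_y‖² ≥ L`. -/
noncomputable def longEdgeCount {n d : ℕ} (v : Fin n → EuclideanSpace ℝ (Fin d))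
    (M : EuclideanSpace ℝ (Fin d) → Finset (Fin n × Fin n)) (L : ℝ)
    (us : List (EuclideanSpace ℝ (Fin d))) : ℕ :=
  {e : Fin n × Fin n | ChainEdge M us e.1 e.2 ∧ L ≤ ‖v e.1 - v e.2‖ ^ 2}.ncard

/-! Take `K = R' = R` and follow chains whose successive edges lie in the matchings of the
correlated matrices `U₁, …, U_R`. Two estimates are compared, with `Y = R² log (1/δ)`.

Survival (`le_sum_avg_chainSum`): pass to a vertex set where every expected degree is at least
`δ/4`. The skew symmetry of the cover makes in- and out-degrees equal. For one resampling step `T`,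
reverse hypercontractivity gives `(E √h)² E f^(1/K) ≤ E h (T f)^(1/K)`. Taking for `h` the event
that a vertex is entered, and for `f` the survival of the remaining chain, each extra step costs
only a factor `(δ/4)²` in the sum of `1/K`-th moments. Convexity of `y ↦ y^K` then gives an expected
number of full chains of at least `(δ/4)^(2R²) (δ/2) n ≥ e^(-8Y) n`.

Short chains are rarer (`avg_short_chainSum_le`): each edge gains at least `σ` in the current
direction, and a gain decays by at most a factor `3` over the remaining steps because `(1 - 1/R)^i ≥
1/3`. While all vertices stay within squared distance `L` of the start, each step adds noise of
variance at most `2L/R`. So either the final projection exceeds `Rσ/6`, or an exponential moment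
bound applies. The final direction is uniform, so a union bound over the `n` possible ends controls
the first case. With `L` of order `σ² R² / log n` both cases together have probability at most `2
e^(-10Y)` per starting vertex.

Hence most surviving chains visit a far vertex, and the prefix ending there is a long edge. The
sampler exposes that prefix when the shuffle puts the correlated matrices first and the random
length is right, at a cost of `(R+1)^(-R) / R`, again at least `e^(-O(R²))`. -/

/-! ### Averages, supports and costs of random programs -/

namespace RandProg

/-- The expectation of a real function of the returned value. -/
noncomputable def avg {α : Type} : RandProg α → (α → ℝ) → ℝ
  | ret a, f => f a
  | draw m next, f => (∑ i, (next i).avg f) / (m + 1)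

/-- Every value that can be returned satisfies `P`. -/
def Always {α : Type} (P : α → Prop) : RandProg α → Prop
  | ret a => P a
  | draw _ next => ∀ i, (next i).Always P

variable {α β : Type}

@[simp] lemma avg_ret (a : α) (f : α → ℝ) : (ret a).avg f = f a := rfl

lemma avg_draw (m : ℕ) (next : Fin (m + 1) → RandProg α) (f : α → ℝ) :
    (draw m next).avg f = (∑ i, (next i).avg f) / (m + 1) := rfl

@[simp] lemma avg_bind (p : RandProg α) (q : α → RandProg β) (f : β → ℝ) :
    (p.bind q).avg f = p.avg fun a => (q a).avg f := by
  induction p with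
  | ret a => rfl
  | draw m next ih => simp only [bind, avg_draw, ih]

@[simp] lemma avg_map (p : RandProg α) (g : α → β) (f : β → ℝ) :
    (p.map g).avg f = p.avg fun a => f (g a) := by
  simp [map]

lemma avg_add (p : RandProg α) (f g : α → ℝ) :
    p.avg (fun a => f a + g a) = p.avg f + p.avg g := by
  induction p with
  | ret a => rfl
  | draw m next ih => simp only [avg_draw, ih, Finset.sum_add_distrib, add_div]

lemma avg_const_mul (p : RandProg α) (c : ℝ) (f : α → ℝ) :
    p.avg (fun a => c * f a) = c * p.avg f := by
  induction p with
  | ret a => rfl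
  | draw m next ih => simp only [avg_draw, ih, ← Finset.mul_sum, mul_div_assoc]

lemma avg_mul_const (p : RandProg α) (c : ℝ) (f : α → ℝ) :
    p.avg (fun a => f a * c) = p.avg f * c := by
  simp_rw [mul_comm _ c, avg_const_mul]

@[simp] lemma avg_const (p : RandProg α) (c : ℝ) : p.avg (fun _ => c) = c := by
  induction p with
  | ret a => rfl
  | draw m next ih =>
    simp only [avg_draw, ih, Finset.sum_const, Finset.card_univ, Fintype.card_fin, nsmul_eq_mul]
    push_cast
    field_simp

lemma avg_sum {ι : Type*} (s : Finset ι) (p : RandProg α) (f : ι → α → ℝ) :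
    p.avg (fun a => ∑ i ∈ s, f i a) = ∑ i ∈ s, p.avg (f i) := by
  classical
  induction s using Finset.induction_on with
  | empty => simp
  | insert i s hi ih => simp only [Finset.sum_insert hi, avg_add, ih]

lemma avg_mono_of_always {P : α → Prop} {p : RandProg α} (hp : p.Always P) {f g : α → ℝ}
    (h : ∀ a, P a → f a ≤ g a) : p.avg f ≤ p.avg g := by
  induction p with
  | ret a => exact h a hp
  | draw m next ih =>
    simp only [avg_draw]
    gcongr with i
    exact ih i (hp i)

lemma always_true (p : RandProg α) : p.Always fun _ => True := by
  induction p with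
  | ret a => trivial
  | draw m next ih => exact ih

lemma avg_mono (p : RandProg α) {f g : α → ℝ} (h : ∀ a, f a ≤ g a) : p.avg f ≤ p.avg g :=
  avg_mono_of_always p.always_true fun a _ => h a

lemma avg_nonneg (p : RandProg α) {f : α → ℝ} (h : ∀ a, 0 ≤ f a) : 0 ≤ p.avg f := by
  simpa using p.avg_mono h

lemma avg_comm (p : RandProg α) (q : RandProg β) (f : α → β → ℝ) :
    (p.avg fun a => q.avg (f a)) = q.avg fun b => p.avg fun a => f a b := by
  induction p with
  | ret a => rfl
  | draw m next ih =>
    simp only [avg_draw, ih, div_eq_mul_inv, avg_mul_const, avg_sum]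

lemma Always.bind {P : α → Prop} {Q : β → Prop} {p : RandProg α} {q : α → RandProg β}
    (hp : p.Always P) (hq : ∀ a, P a → (q a).Always Q) : (p.bind q).Always Q := by
  induction p with
  | ret a => exact hq a hp
  | draw m next ih => exact fun i => ih i (hp i)

lemma Always.map {P : α → Prop} {Q : β → Prop} {p : RandProg α} {g : α → β}
    (hp : p.Always P) (hq : ∀ a, P a → Q (g a)) : (p.map g).Always Q :=
  hp.bind hq

lemma always_of_mem_support {P : α → Prop} {p : RandProg α} (hp : p.Always P) {a : α}
    (ha : a ∈ p.law.support) : P a := by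
  induction p with
  | ret b =>
    simp only [law, PMF.support_pure, Set.mem_singleton_iff] at ha
    exact ha ▸ hp
  | draw m next ih =>
    simp only [law, PMF.mem_support_bind_iff] at ha
    obtain ⟨i, -, hi⟩ := ha
    exact ih i (hp i) hi

lemma cost_bind_le {P : α → Prop} {p : RandProg α} {q : α → RandProg β} {c : ℕ}
    (hp : p.Always P) (hq : ∀ a, P a → (q a).cost ≤ c) : (p.bind q).cost ≤ p.cost + c := by
  induction p with
  | ret a => simpa [RandProg.bind, cost] using hq a hp
  | draw m next ih =>
    simp only [RandProg.bind, cost, add_assoc]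
    gcongr
    refine Finset.sup_le fun i hi => (ih i (hp i)).trans ?_
    gcongr
    exact Finset.le_sup (f := fun i => (next i).cost) hi

lemma cost_map (p : RandProg α) (g : α → β) : (p.map g).cost = p.cost := by
  induction p with
  | ret a => rfl
  | draw m next ih =>
    have : ∀ i, ((next i).bind fun a => ret (g a)).cost = (next i).cost := ih
    simp only [map, RandProg.bind, cost, this]

lemma cost_tuple_le (n : ℕ) (p : Fin n → RandProg α) (c : ℕ) (h : ∀ i, (p i).cost ≤ c) :
    (tuple n p).cost ≤ n * c := by
  induction n with
  | zero => simp [tuple, cost]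
  | succ n ih =>
    refine (cost_bind_le (always_true _) (c := n * c) fun a _ => ?_).trans ?_
    · rw [cost_map]
      exact ih _ fun i => h _
    · have := h 0
      lia

lemma avg_tuple_succ (n : ℕ) (p : Fin (n + 1) → RandProg α) (f : (Fin (n + 1) → α) → ℝ) :
    (tuple (n + 1) p).avg f =
      (p 0).avg fun a => (tuple n fun i => p i.succ).avg fun t => f (Fin.cons a t) := by
  simp [tuple]

lemma avg_tuple_prod (n : ℕ) (p : Fin n → RandProg α) (g : Fin n → α → ℝ) :
    (tuple n p).avg (fun t => ∏ i, g i (t i)) = ∏ i, (p i).avg (g i) := by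
  induction n with
  | zero => simp [tuple]
  | succ n ih =>
    simp only [avg_tuple_succ, Fin.prod_univ_succ, Fin.cons_zero, Fin.cons_succ, avg_const_mul,
      avg_mul_const]
    rw [ih]

lemma avg_tuple_uniform [Fintype α] (p : RandProg α)
    (hp : ∀ f : α → ℝ, p.avg f = (∑ a, f a) / Fintype.card α) (n : ℕ) (f : (Fin n → α) → ℝ) :
    (tuple n fun _ => p).avg f = (∑ t, f t) / Fintype.card (Fin n → α) := by
  induction n with
  | zero =>
    simp only [tuple, avg_ret, Fintype.sum_unique, Fintype.card_unique, Nat.cast_one, div_one]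
    exact congrArg f (Subsingleton.elim _ _)
  | succ n ih =>
    rw [avg_tuple_succ, hp]
    simp_rw [ih]
    rw [← (Fin.consEquiv fun _ : Fin (n + 1) => α).sum_comp, Fintype.sum_prod_type, ← Finset.sum_div,
      div_div]
    simp only [Fintype.card_fun, Fintype.card_fin, pow_succ, Nat.cast_mul]
    rfl

lemma cost_shuffle_le (us ws : List α) :
    2 * (shuffle us ws).cost ≤
      (us.length + ws.length) * (us.length + ws.length + 1) := by
  induction us, ws using shuffle.induct with
  | case1 ws => simp [shuffle, cost]
  | case2 us h => cases us <;> simp_all [shuffle, cost]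
  | case3 u us w ws ih1 ih2 =>
    have key : (Finset.univ.sup fun i : Fin (us.length + ws.length + 1 + 1) =>
        (if i.val < us.length + 1 then (shuffle us (w :: ws)).map fun l => u :: l
          else (shuffle (u :: us) ws).map fun l => w :: l).cost) ≤
        (us.length + ws.length + 1) * (us.length + ws.length + 1 + 1) / 2 := by
      refine Finset.sup_le fun i _ => ?_
      rw [Nat.le_div_iff_mul_le two_pos]
      split_ifs
      · rw [cost_map, mul_comm]
        exact ih1.trans (by simp only [List.length_cons]; ring_nf; rfl)
      · rw [cost_map, mul_comm]
        exact ih2.trans (by simp only [List.length_cons]; ring_nf; rfl)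
    rw [shuffle, cost]
    have h2 := Nat.mul_le_of_le_div _ _ _ key
    simp only [List.length_cons]
    nlinarith

/-- Only the outcome in which all of `us` comes first is kept. While `us` is nonempty, the next
element is taken from it with probability at least `1 / (ws.length + 1)`. -/
lemma le_avg_shuffle (us ws : List α) (F : List α → ℝ) (hF : ∀ l, 0 ≤ F l) :
    (1 / ((ws.length : ℝ) + 1)) ^ us.length * F (us ++ ws) ≤ (shuffle us ws).avg F := by
  induction us generalizing F with
  | nil => simp [shuffle]
  | cons u us ih =>
    cases ws with
    | nil => simp [shuffle]
    | cons w ws =>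
      rw [shuffle, avg_draw]
      have h1 := ih (fun l => F (u :: l)) fun l => hF _
      set A := (shuffle us (w :: ws)).avg fun l => F (u :: l) with hA
      have hA0 : 0 ≤ A := avg_nonneg _ fun l => hF _
      have hsum : ((us.length : ℝ) + 1) * A ≤ ∑ i : Fin (us.length + ws.length + 1 + 1),
          (if i.val < us.length + 1 then (shuffle us (w :: ws)).map fun l => u :: l
            else (shuffle (u :: us) ws).map fun l => w :: l).avg F := by
        calc ((us.length : ℝ) + 1) * A
            = ∑ i : Fin (us.length + ws.length + 1 + 1),
                if i.val < us.length + 1 then A else 0 := by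
              rw [Finset.sum_ite]
              simp only [Finset.sum_const, nsmul_eq_mul, mul_zero, add_zero]
              congr 1
              have : (Finset.univ.filter fun i : Fin (us.length + ws.length + 1 + 1) =>
                  i.val < us.length + 1).card = us.length + 1 := by
                rw [Fin.card_filter_val_lt]
                lia
              rw [this]
              push_cast
              rfl
          _ ≤ _ := by
              refine Finset.sum_le_sum fun i _ => ?_
              split_ifs
              · simp [hA]
              · exact avg_nonneg _ hF
      have h3 : 1 / (((w :: ws).length : ℝ) + 1) * A ≤ ((us.length : ℝ) + 1) * A /
          ((us.length + ws.length + 1 : ℕ) + 1) := by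
        rw [mul_div_right_comm]
        refine mul_le_mul_of_nonneg_right ?_ hA0
        rw [div_le_div_iff₀ (by positivity) (by positivity)]
        simp only [List.length_cons]
        push_cast
        nlinarith [mul_nonneg (Nat.cast_nonneg (α := ℝ) us.length)
          (Nat.cast_nonneg (α := ℝ) ws.length), Nat.cast_nonneg (α := ℝ) us.length]
      calc (1 / (((w :: ws).length : ℝ) + 1)) ^ (u :: us).length * F (u :: us ++ w :: ws)
          = 1 / (((w :: ws).length : ℝ) + 1) *
            ((1 / (((w :: ws).length : ℝ) + 1)) ^ us.length * F (u :: (us ++ w :: ws))) := by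
            rw [List.length_cons (a := u), pow_succ, List.cons_append]; ring
        _ ≤ 1 / (((w :: ws).length : ℝ) + 1) * A := by gcongr
        _ ≤ _ := h3.trans (by gcongr)

end RandProg

lemma expectation_pure {α : Type} (a : α) (f : α → ℝ≥0∞) : expectation (PMF.pure a) f = f a := by
  classical
  simp [expectation, PMF.pure_apply]

lemma expectation_bind {α β : Type} (p : PMF α) (q : α → PMF β) (f : β → ℝ≥0∞) :
    expectation (p.bind q) f = expectation p fun a => expectation (q a) f := by
  simp only [expectation, PMF.bind_apply, ← ENNReal.tsum_mul_right, ← ENNReal.tsum_mul_left]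
  rw [ENNReal.tsum_comm]
  simp only [mul_assoc]

lemma expectation_uniformOfFintype {α : Type} [Fintype α] [Nonempty α] (f : α → ℝ)
    (hf : ∀ a, 0 ≤ f a) :
    expectation (PMF.uniformOfFintype α) (fun a => ENNReal.ofReal (f a)) =
      ENNReal.ofReal ((∑ a, f a) / Fintype.card α) := by
  have hc : (0 : ℝ) < Fintype.card α := by exact_mod_cast Fintype.card_pos
  simp only [expectation, PMF.uniformOfFintype_apply, tsum_fintype, ← Finset.mul_sum]
  rw [← ENNReal.ofReal_sum_of_nonneg fun i _ => hf i, ENNReal.ofReal_div_of_pos hc,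
    ENNReal.ofReal_natCast, mul_comm, div_eq_mul_inv]

/-- Bridge from the `PMF` in the theorem to finite real averages, in which all estimates are made.
-/
lemma RandProg.expectation_law {α : Type} (p : RandProg α) (f : α → ℝ) (hf : ∀ a, 0 ≤ f a) :
    expectation p.law (fun a => ENNReal.ofReal (f a)) = ENNReal.ofReal (p.avg f) := by
  induction p with
  | ret a => exact expectation_pure _ _
  | draw m next ih =>
    rw [law, expectation_bind]
    simp_rw [ih]
    rw [expectation_uniformOfFintype _ fun i => avg_nonneg _ hf, avg_draw]
    simp

/-! ### Scalar inequalities behind reverse hypercontractivity -/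

/-- This is what the pointwise inequality below reduces to after two applications of AM-GM, with `K
= m + 1`. -/
lemma sq_mul_add_inv_sub_two_le {w : ℝ} (hw : 0 < w) (m : ℕ) :
    (m : ℝ) ^ 2 * (w + w⁻¹ - 2) ≤ w ^ m + (w ^ m)⁻¹ - 2 := by
  -- with `w = exp (2 x)`, both sides are squares of hyperbolic sines
  have main : ∀ x : ℝ, ∀ m : ℕ, (m : ℝ) ^ 2 * Real.sinh x ^ 2 ≤ Real.sinh (m * x) ^ 2 := by
    intro x m
    have hpos : ∀ x : ℝ, 0 ≤ x → ∀ m : ℕ, (m : ℝ) * Real.sinh x ≤ Real.sinh (m * x) := by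
      intro x hx m
      induction m with
      | zero => simp
      | succ m ih =>
        push_cast
        rw [add_mul, add_mul, one_mul, one_mul, Real.sinh_add]
        have h1 : 0 ≤ Real.sinh x := Real.sinh_nonneg_iff.2 hx
        have h2 : 0 ≤ Real.sinh (m * x) := Real.sinh_nonneg_iff.2 (by positivity)
        nlinarith [mul_nonneg h2 (sub_nonneg.2 (Real.one_le_cosh x)),
          mul_nonneg h1 (sub_nonneg.2 (Real.one_le_cosh (m * x)))]
    rcases le_total 0 x with hx | hx
    · rw [← mul_pow]
      exact pow_le_pow_left₀ (mul_nonneg m.cast_nonneg (Real.sinh_nonneg_iff.2 hx)) (hpos x hx m) 2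
    · have h := hpos (-x) (by linarith) m
      have h' : 0 ≤ Real.sinh (-x) := Real.sinh_nonneg_iff.2 (by linarith)
      have := pow_le_pow_left₀ (mul_nonneg m.cast_nonneg h') h 2
      rw [mul_neg, Real.sinh_neg, Real.sinh_neg] at this
      nlinarith [this]
  have hs : ∀ t : ℝ, Real.exp t + (Real.exp t)⁻¹ - 2 = 4 * Real.sinh (t / 2) ^ 2 := by
    intro t
    have h2 : Real.exp t = Real.exp (t / 2) ^ 2 := by rw [← Real.exp_nat_mul]; congr 1; push_cast; ring
    rw [Real.sinh_eq, h2, Real.exp_neg]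
    field_simp
    ring
  have hwm : w ^ m = Real.exp (m * Real.log w) := by rw [Real.exp_nat_mul, Real.exp_log hw]
  have h := main (Real.log w / 2) m
  rw [hwm, hs]
  conv_lhs => rw [← Real.exp_log hw]
  rw [hs]
  rw [← mul_div_assoc] at h
  linarith

/-- A pointwise bound that, averaged over `f` of mean one, is the reverse hypercontractive
inequality for the operator that resamples with probability `1 / K`. -/
lemma rpow_add_rpow_neg_le {K : ℕ} (hK : 1 ≤ K) {f : ℝ} (hf : 0 ≤ f) {g : ℝ} (hg0 : 0 < g)
    (hg : g = 1 / K + (1 - 1 / K) * f) :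
    f ^ (1 / K : ℝ) + g ^ (-(1 / K : ℝ)) ≤ 2 + (f - 1) / K ^ 2 := by
  obtain ⟨m, rfl⟩ : ∃ m, K = m + 1 := ⟨K - 1, by lia⟩
  rcases Nat.eq_zero_or_pos m with rfl | hm
  · have hg1 : g = 1 := by rw [hg]; norm_num
    simp [hg1]
    linarith
  have hm' : (0 : ℝ) < m := by exact_mod_cast hm
  -- With `w` the `m`-th root of `g`, the power `f^(1/K)` is the weighted geometric mean of `f/g`
  -- and `w`, with weights `1/K` and `m/K`; similarly `g^(-1/K)` is one of `w⁻¹` and `1`.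
  obtain ⟨w, hw, hwm⟩ : ∃ w : ℝ, 0 < w ∧ w ^ m = g :=
    ⟨g ^ (1 / m : ℝ), by positivity, by
      rw [← Real.rpow_natCast, ← Real.rpow_mul hg0.le]; field_simp; simp⟩
  set s : ℝ := 1 / ((m + 1 : ℕ) : ℝ) with hs
  have hM : ((m + 1 : ℕ) : ℝ) = m + 1 := by push_cast; ring
  have hfg : f = ((m + 1) * g - 1) / m := by
    rw [hg, hs, hM]; field_simp; ring
  -- weighted AM-GM for the two terms
  have h1 : f ^ s ≤ (f / g + m * w) / (m + 1) := by
    have hwt : s + m * s = 1 := by rw [hs, hM]; field_simp; ring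
    have := Real.geom_mean_le_arith_mean2_weighted (w₁ := s) (w₂ := m * s) (p₁ := f / g)
      (p₂ := w) (by positivity) (by positivity) (by positivity) hw.le hwt
    have he : (f / g) ^ s * w ^ (m * s) = f ^ s := by
      rw [Real.rpow_mul hw.le, Real.rpow_natCast, hwm, ← Real.mul_rpow (by positivity) hg0.le]
      congr 1; field_simp
    rw [he] at this
    refine this.trans_eq ?_
    rw [hs, hM]; field_simp
  have h2 : g ^ (-s) ≤ (m * w⁻¹ + 1) / (m + 1) := by
    have hwt : m * s + s = 1 := by rw [hs, hM]; field_simp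
    have := Real.geom_mean_le_arith_mean2_weighted (w₁ := m * s) (w₂ := s) (p₁ := w⁻¹)
      (p₂ := 1) (by positivity) (by positivity) (by positivity) zero_le_one hwt
    have he : w⁻¹ ^ (m * s) * 1 ^ s = g ^ (-s) := by
      rw [Real.one_rpow, mul_one, Real.rpow_mul (by positivity), Real.rpow_natCast, inv_pow, hwm,
        Real.inv_rpow hg0.le, Real.rpow_neg hg0.le]
    rw [he] at this
    refine this.trans_eq ?_
    rw [hs, hM]; field_simp
  have h3 := sq_mul_add_inv_sub_two_le hw m
  rw [hwm] at h3
  -- Since `f` is affine in `g`, clearing denominators turns this into exactly `h3`.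
  have h4 : (f / g + m * w) / (m + 1) + (m * w⁻¹ + 1) / (m + 1) ≤ 2 + (f - 1) / (m + 1) ^ 2 := by
    have e1 : f / g = ((m + 1) - g⁻¹) / m := by rw [hfg]; field_simp
    have e2 : (f - 1) = (m + 1) * (g - 1) / m := by rw [hfg]; field_simp; ring
    rw [e1, e2]
    have e3 : (m + 1) * (g - 1) / m / ((m : ℝ) + 1) ^ 2 = (g - 1) / m / (m + 1) := by
      field_simp
    rw [e3, ← add_div, ← sub_nonneg]
    have e4 : 2 + (g - 1) / m / (m + 1) -
        (((m + 1) - g⁻¹) / m + m * w + (m * w⁻¹ + 1)) / (m + 1) =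
        ((g + g⁻¹ - 2) - m ^ 2 * (w + w⁻¹ - 2)) / m / (m + 1) := by
      field_simp
      ring
    rw [e4]
    have : 0 ≤ (g + g⁻¹ - 2) - m ^ 2 * (w + w⁻¹ - 2) := by linarith
    positivity
  rw [hM]
  linarith

/-! ### Tensorization of reverse hypercontractivity and stationarity -/

namespace RandProg

variable {α β : Type}

/-- The two-function reverse hypercontractive inequality with exponent `1 / K` for the operator
`f ↦ (κ ·).avg f` on the space with distribution `μ`. -/
def ReverseHypercontractive (K : ℕ) (μ : RandProg α) (κ : α → RandProg α) : Prop :=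
  ∀ h f : α → ℝ, (∀ a, 0 ≤ h a) → (∀ a, 0 ≤ f a) →
    (μ.avg fun a => √(h a)) ^ 2 * (μ.avg fun a => f a ^ (1 / K : ℝ)) ≤
      μ.avg fun a => h a * (κ a).avg f ^ (1 / K : ℝ)

/-- The square root is what makes the inequality tensorize: `√H` for the `H` below is the average of
`√h` over the last coordinates. Apply the one-coordinate inequality to `H` with those coordinates of
`f` frozen, then induction with the first coordinate of `h` frozen. -/
lemma ReverseHypercontractive.tuple {K : ℕ} {μ : RandProg α} {κ : α → RandProg α}
    (hμ : ReverseHypercontractive K μ κ) (n : ℕ) :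
    ReverseHypercontractive K (RandProg.tuple n fun _ => μ)
      fun t => RandProg.tuple n fun i => κ (t i) := by
  induction n with
  | zero =>
    intro h f hh hf
    simp [RandProg.tuple, Real.sq_sqrt (hh _)]
  | succ n ih =>
    intro h f hh hf
    simp only [avg_tuple_succ, Fin.cons_zero, Fin.cons_succ]
    set ν := RandProg.tuple n fun _ => μ
    let H : α → ℝ := fun a => (ν.avg fun t => √(h (Fin.cons a t))) ^ 2
    have hH : ∀ a, √(H a) = ν.avg fun t => √(h (Fin.cons a t)) := fun a =>
      Real.sqrt_sq (avg_nonneg _ fun _ => Real.sqrt_nonneg _)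
    calc (μ.avg fun a => ν.avg fun t => √(h (Fin.cons a t))) ^ 2 *
          (μ.avg fun a => ν.avg fun t => f (Fin.cons a t) ^ (1 / K : ℝ))
        = ν.avg fun t => (μ.avg fun a => √(H a)) ^ 2 *
            (μ.avg fun a => f (Fin.cons a t) ^ (1 / K : ℝ)) := by
          simp only [hH]
          rw [avg_const_mul, avg_comm μ ν fun a t => f (Fin.cons a t) ^ (1 / K : ℝ)]
      _ ≤ ν.avg fun t => μ.avg fun a => H a *
            ((κ a).avg fun a' => f (Fin.cons a' t)) ^ (1 / K : ℝ) :=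
          avg_mono _ fun t => hμ H _ (fun a => sq_nonneg _) fun a => hf _
      _ = μ.avg fun a => (ν.avg fun t => √(h (Fin.cons a t))) ^ 2 *
            ν.avg fun t => ((κ a).avg fun a' => f (Fin.cons a' t)) ^ (1 / K : ℝ) := by
          rw [avg_comm ν μ]
          simp only [avg_const_mul, H]
      _ ≤ _ := by
          refine avg_mono _ fun a => (ih _ _ (fun t => hh _) fun t =>
            avg_nonneg _ fun a' => hf _).trans_eq ?_
          simp only [avg_comm (κ a)]

lemma ReverseHypercontractive.map {K : ℕ} {μ : RandProg α} {κ : α → RandProg α}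
    (hμ : ReverseHypercontractive K μ κ) (e : α → β) (e' : β → α) (he : ∀ a, e' (e a) = a) :
    ReverseHypercontractive K (μ.map e) fun b => (κ (e' b)).map e := by
  intro h f hh hf
  simpa only [avg_map, he] using hμ (fun a => h (e a)) (fun a => f (e a)) (fun _ => hh _)
    fun _ => hf _

/-- The kernel `κ` preserves the distribution of `μ`. -/
def Stationary (μ : RandProg α) (κ : α → RandProg α) : Prop :=
  ∀ f : α → ℝ, (μ.avg fun a => (κ a).avg f) = μ.avg f

lemma Stationary.tuple {μ : RandProg α} {κ : α → RandProg α} (hμ : Stationary μ κ) (n : ℕ) :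
    Stationary (RandProg.tuple n fun _ => μ) fun t => RandProg.tuple n fun i => κ (t i) := by
  induction n with
  | zero => intro f; simp [RandProg.tuple]
  | succ n ih =>
    intro f
    simp only [avg_tuple_succ, Fin.cons_zero, Fin.cons_succ]
    set ν := RandProg.tuple n fun _ => μ
    have h1 : ∀ a, (ν.avg fun t => (κ a).avg fun a' =>
        (RandProg.tuple n fun i => κ (t i)).avg fun t' => f (Fin.cons a' t')) =
        (κ a).avg fun a' => ν.avg fun t' => f (Fin.cons a' t') := fun a => by
      rw [avg_comm]
      congr 1
      funext a'
      exact ih fun t' => f (Fin.cons a' t')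
    simp only [h1]
    exact hμ _

lemma Stationary.map {μ : RandProg α} {κ : α → RandProg α} (hμ : Stationary μ κ) (e : α → β)
    (e' : β → α) (he : ∀ a, e' (e a) = a) :
    Stationary (μ.map e) fun b => (κ (e' b)).map e := by
  intro f
  simpa only [avg_map, he] using hμ fun a => f (e a)

end RandProg

open RandProg

/-! ### Random signs and sign matrices -/

@[simp] lemma avg_randomSign (f : ℤˣ → ℝ) : randomSign.avg f = (f 1 + f (-1)) / 2 := by
  simp [randomSign, avg_draw, Fin.sum_univ_two]
  ring

lemma avg_correlatedSign {K : ℕ} (hK : 1 ≤ K) (s : ℤˣ) (f : ℤˣ → ℝ) :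
    (correlatedSign K s).avg f = 1 / K * ((f 1 + f (-1)) / 2) + (1 - 1 / K) * f s := by
  obtain ⟨m, rfl⟩ : ∃ m, K = m + 1 := ⟨K - 1, by lia⟩
  simp only [correlatedSign, avg_draw, Nat.add_sub_cancel, Fin.sum_univ_succ, if_true,
    avg_randomSign, Fin.succ_ne_zero, if_false, avg_ret, Finset.sum_const, Finset.card_univ,
    Fintype.card_fin, nsmul_eq_mul]
  push_cast
  field_simp
  ring

/-- Normalize `f` to mean one and let `g` be its image under resampling. Averaging
`rpow_add_rpow_neg_le` gives `E f^s + E g^(-s) ≤ 2` with `s = 1/K`, so `E f^s · E g^(-s) ≤ 1` by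
AM-GM. Cauchy–Schwarz in the form `(E √h)² ≤ E (h g^s) · E g^(-s)` finishes. -/
lemma reverseHypercontractive_correlatedSign {K : ℕ} (hK : 1 ≤ K) :
    ReverseHypercontractive K randomSign (correlatedSign K) := by
  intro h f hh hf
  have hK' : (1 : ℝ) ≤ K := by exact_mod_cast hK
  have hs : (0 : ℝ) < 1 / K := by positivity
  have hs1 : (1 : ℝ) / K ≤ 1 := by rw [div_le_one (by positivity)]; exact hK'
  set s : ℝ := 1 / K with hsdef
  simp only [avg_randomSign, avg_correlatedSign hK, ← hsdef]
  set μ : ℝ := (f 1 + f (-1)) / 2 with hμ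
  have hμ0 : 0 ≤ μ := by have := hf 1; have := hf (-1); positivity
  rcases hμ0.eq_or_lt with h0 | hpos
  · have e1 : f 1 = 0 := by linarith [hf 1, hf (-1)]
    have e2 : f (-1) = 0 := by linarith [hf 1, hf (-1)]
    simp [e1, e2, ← h0, Real.zero_rpow hs.ne']
  have hg : ∀ i, 0 < s * μ + (1 - s) * f i := fun i =>
    add_pos_of_pos_of_nonneg (mul_pos hs hpos) (mul_nonneg (by linarith) (hf i))
  have key : ∀ i, (f i / μ) ^ s + ((s * μ + (1 - s) * f i) / μ) ^ (-s) ≤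
      2 + (f i / μ - 1) / K ^ 2 := fun i =>
    rpow_add_rpow_neg_le hK (div_nonneg (hf i) hμ0) (div_pos (hg i) hpos) (by
      rw [← hsdef]; field_simp)
  have k1 := key 1
  have k2 := key (-1)
  set a := s * μ + (1 - s) * f 1
  set b := s * μ + (1 - s) * f (-1)
  have ha : 0 < a := hg 1
  have hb : 0 < b := hg (-1)
  have hsum : (f 1 / μ) ^ s + (f (-1) / μ) ^ s + ((a / μ) ^ (-s) + (b / μ) ^ (-s)) ≤ 4 := by
    have : (f 1 / μ - 1) / (K : ℝ) ^ 2 + (f (-1) / μ - 1) / (K : ℝ) ^ 2 = 0 := by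
      rw [← add_div]
      have : f 1 / μ - 1 + (f (-1) / μ - 1) = 0 := by
        field_simp
        rw [hμ]; ring
      rw [this, zero_div]
    linarith
  rw [Real.div_rpow (hf _) hμ0, Real.div_rpow (hf _) hμ0, Real.rpow_neg (by positivity),
    Real.rpow_neg (by positivity), Real.div_rpow ha.le hμ0, Real.div_rpow hb.le hμ0, inv_div,
    inv_div] at hsum
  have hA : 0 < a ^ s := by positivity
  have hB : 0 < b ^ s := by positivity
  have hM : 0 < μ ^ s := by positivity
  have hX : 0 ≤ f 1 ^ s := Real.rpow_nonneg (hf _) _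
  have hY : 0 ≤ f (-1) ^ s := Real.rpow_nonneg (hf _) _
  generalize a ^ s = A at *
  generalize b ^ s = B at *
  generalize μ ^ s = N at *
  generalize f 1 ^ s = X at *
  generalize f (-1) ^ s = Y at *
  have hprod : (X + Y) * (1 / A + 1 / B) ≤ 4 := by
    have e : (X + Y) * (1 / A + 1 / B) = (X / N + Y / N) * (N / A + N / B) := by field_simp
    rw [e]
    nlinarith [sq_nonneg ((X / N + Y / N) - (N / A + N / B)),
      add_nonneg (div_nonneg hX hM.le) (div_nonneg hY hM.le),
      add_pos (div_pos hM hA) (div_pos hM hB)]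
  have hCS : (√(h 1) + √(h (-1))) ^ 2 ≤ (h 1 * A + h (-1) * B) * (1 / A + 1 / B) := by
    have e1 : h 1 = √(h 1) ^ 2 := (Real.sq_sqrt (hh 1)).symm
    have e2 : h (-1) = √(h (-1)) ^ 2 := (Real.sq_sqrt (hh (-1))).symm
    generalize √(h 1) = p at *
    generalize √(h (-1)) = q at *
    rw [e1, e2]
    have : (p ^ 2 * A + q ^ 2 * B) * (1 / A + 1 / B) - (p + q) ^ 2 = (p * A - q * B) ^ 2 / (A * B) := by
      field_simp
      ring
    have : 0 ≤ (p * A - q * B) ^ 2 / (A * B) := by positivity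
    linarith
  have hZ : 0 ≤ h 1 * A + h (-1) * B := add_nonneg (mul_nonneg (hh _) hA.le) (mul_nonneg (hh _) hB.le)
  nlinarith [mul_le_mul_of_nonneg_right hCS (add_nonneg hX hY), mul_le_mul_of_nonneg_left hprod hZ]

lemma reverseHypercontractive_correlatedCopy {K : ℕ} (hK : 1 ≤ K) (d k : ℕ) :
    ReverseHypercontractive K (randomMatrix d k) (correlatedCopy K) :=
  (((reverseHypercontractive_correlatedSign hK).tuple k).tuple d).map Matrix.of (fun U => U)
    fun _ => rfl

lemma avg_randomMatrix {d k : ℕ} (f : SignMatrix d k → ℝ) :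
    (randomMatrix d k).avg f = (∑ U, f U) / Fintype.card (SignMatrix d k) := by
  rw [randomMatrix, avg_map, avg_tuple_uniform _ (avg_tuple_uniform _ (fun g => ?_) k) d]
  · congr 1
  · rw [avg_randomSign, Fintype.card_units_int]
    simp

lemma avg_randomMatrix_neg {d k : ℕ} (f : SignMatrix d k → ℝ) :
    (randomMatrix d k).avg (fun U => f (-U)) = (randomMatrix d k).avg f := by
  rw [avg_randomMatrix, avg_randomMatrix]
  congr 1
  exact Equiv.sum_comp (Equiv.neg (SignMatrix d k)) f

lemma stationary_correlatedCopy {K : ℕ} (hK : 1 ≤ K) (d k : ℕ) :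
    Stationary (randomMatrix d k) (correlatedCopy K) := by
  have h : Stationary randomSign (correlatedSign K) := fun f => by
    simp only [avg_randomSign, avg_correlatedSign hK]
    ring
  exact ((h.tuple k).tuple d).map Matrix.of (fun U => U) fun _ => rfl

lemma direction_neg {d k : ℕ} (U : SignMatrix d k) : direction (-U) = -direction U := by
  ext i
  simp [direction, Matrix.mulVec, dotProduct]

/-! ### Exponential moments of projections to random directions -/

lemma inner_direction {d k : ℕ} (w : EuclideanSpace ℝ (Fin d)) (U : SignMatrix d k) :
    inner ℝ w (direction U) = ∑ i, ∑ j, w i / √(k : ℝ) * ((U i j : ℤ) : ℝ) := by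
  rw [PiLp.inner_apply]
  refine Finset.sum_congr rfl fun i _ => ?_
  simp only [direction, Matrix.mulVec, dotProduct, Matrix.map_apply, RCLike.inner_apply,
    conj_trivial, Finset.sum_mul]
  refine Finset.sum_congr rfl fun j _ => ?_
  ring

lemma sum_sum_sq_div_sqrt {d k : ℕ} (hk : 1 ≤ k) (w : EuclideanSpace ℝ (Fin d)) :
    ∑ i, ∑ _j : Fin k, (w i / √(k : ℝ)) ^ 2 = ‖w‖ ^ 2 := by
  have hk' : (0 : ℝ) < k := by exact_mod_cast hk
  rw [EuclideanSpace.norm_sq_eq]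
  refine Finset.sum_congr rfl fun i _ => ?_
  rw [Finset.sum_const, Finset.card_univ, Fintype.card_fin, nsmul_eq_mul, div_pow,
    Real.sq_sqrt hk'.le, Real.norm_eq_abs, sq_abs]
  field_simp

/-- The centred sign has variance `1 - (1 - 1/K)² ≤ 2/K`. The factor `1/K` is essential: it keeps
the noise accumulated over `K` steps bounded. The restriction on `θ` keeps exponents in `[-1, 1]`,
where `exp y ≤ 1 + y + y²`. -/
lemma correlatedSign_mgf_le {K : ℕ} (hK : 1 ≤ K) (s : ℤˣ) {θ : ℝ} (hθ : |θ| ≤ 1 / 2) :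
    ((correlatedSign K s).avg fun v =>
      Real.exp (θ * (((v : ℤ) : ℝ) - (1 - 1 / K) * ((s : ℤ) : ℝ)))) ≤
      Real.exp (2 * θ ^ 2 / K) := by
  have hK' : (1 : ℝ) ≤ K := by exact_mod_cast hK
  have hp0 : (0 : ℝ) < 1 / K := by positivity
  have hp1 : (1 : ℝ) / K ≤ 1 := by rw [div_le_one (by positivity)]; exact hK'
  have hbound : ∀ x : ℝ, |x| ≤ 2 → Real.exp (θ * x) ≤ 1 + θ * x + θ ^ 2 * x ^ 2 := by
    intro x hx
    have h1 : |θ * x| ≤ 1 := by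
      rw [abs_mul]
      nlinarith [abs_nonneg θ, abs_nonneg x]
    have := (abs_le.1 (Real.abs_exp_sub_one_sub_id_le h1)).2
    nlinarith
  have e : 2 * θ ^ 2 / K = 2 * θ ^ 2 * (1 / K) := by ring
  rw [avg_correlatedSign hK, e]
  set p : ℝ := 1 / K
  rcases Int.units_eq_one_or s with rfl | rfl
  · have b1 := hbound (1 - (1 - p) * 1) (abs_le.2 ⟨by linarith, by linarith⟩)
    have b2 := hbound (-1 - (1 - p) * 1) (abs_le.2 ⟨by linarith, by linarith⟩)
    have := Real.add_one_le_exp (2 * θ ^ 2 * p)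
    push_cast
    nlinarith [mul_le_mul_of_nonneg_left b1 hp0.le, mul_le_mul_of_nonneg_left b2 hp0.le,
      mul_nonneg (sq_nonneg θ) (sq_nonneg p), mul_le_mul_of_nonneg_left b1 (sub_nonneg.2 hp1)]
  · have b1 := hbound (1 - (1 - p) * -1) (abs_le.2 ⟨by linarith, by linarith⟩)
    have b2 := hbound (-1 - (1 - p) * -1) (abs_le.2 ⟨by linarith, by linarith⟩)
    have := Real.add_one_le_exp (2 * θ ^ 2 * p)
    push_cast
    nlinarith [mul_le_mul_of_nonneg_left b1 hp0.le, mul_le_mul_of_nonneg_left b2 hp0.le,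
      mul_nonneg (sq_nonneg θ) (sq_nonneg p), mul_le_mul_of_nonneg_left b2 (sub_nonneg.2 hp1)]

lemma avg_correlatedCopy_prod (K : ℕ) {d k : ℕ} (U : SignMatrix d k)
    (g : Fin d → Fin k → ℤˣ → ℝ) :
    ((correlatedCopy K U).avg fun V => ∏ i, ∏ j, g i j (V i j)) =
      ∏ i, ∏ j, (correlatedSign K (U i j)).avg (g i j) := by
  rw [correlatedCopy, avg_map]
  exact (avg_tuple_prod d _ fun i (r : Fin k → ℤˣ) => ∏ j, g i j (r j)).trans
    (Finset.prod_congr rfl fun i _ => avg_tuple_prod k _ (g i))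

lemma avg_randomMatrix_prod {d k : ℕ} (g : Fin d → Fin k → ℤˣ → ℝ) :
    ((randomMatrix d k).avg fun V => ∏ i, ∏ j, g i j (V i j)) =
      ∏ i, ∏ j, randomSign.avg (g i j) := by
  rw [randomMatrix, avg_map]
  exact (avg_tuple_prod d _ fun i (r : Fin k → ℤˣ) => ∏ j, g i j (r j)).trans
    (Finset.prod_congr rfl fun i _ => avg_tuple_prod k _ (g i))

/-- Entries are resampled independently, so the moment factorizes. The hypothesis on `k` makes each
entry's coefficient at most `1/2`; this is where a lower bound on `k` is needed. -/
lemma correlatedCopy_mgf_le {K : ℕ} (hK : 1 ≤ K) {d k : ℕ} (hk : 1 ≤ k) (U : SignMatrix d k)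
    (w : EuclideanSpace ℝ (Fin d)) {t : ℝ} (ht : t ^ 2 * ‖w‖ ^ 2 ≤ k / 4) :
    ((correlatedCopy K U).avg fun V =>
      Real.exp (t * (inner ℝ w (direction V) - (1 - 1 / K) * inner ℝ w (direction U)))) ≤
      Real.exp (2 * t ^ 2 * ‖w‖ ^ 2 / K) := by
  have hk' : (0 : ℝ) < k := by exact_mod_cast hk
  let θ : Fin d → ℝ := fun i => t * (w i / √(k : ℝ))
  have hθ : ∀ i, |θ i| ≤ 1 / 2 := by
    intro i
    refine abs_le_of_sq_le_sq ?_ (by norm_num)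
    have h1 : (w i) ^ 2 ≤ ‖w‖ ^ 2 := by
      rw [EuclideanSpace.norm_sq_eq, ← sq_abs, ← Real.norm_eq_abs]
      exact Finset.single_le_sum (f := fun i => ‖w i‖ ^ 2) (fun i _ => sq_nonneg _)
        (Finset.mem_univ i)
    calc θ i ^ 2 = t ^ 2 * (w i) ^ 2 / k := by
          simp only [θ, mul_pow, div_pow, Real.sq_sqrt hk'.le]; ring
      _ ≤ t ^ 2 * ‖w‖ ^ 2 / k := by gcongr
      _ ≤ (k / 4) / k := by gcongr
      _ = (1 / 2) ^ 2 := by field_simp; norm_num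
  have hexp : ∀ V : SignMatrix d k,
      Real.exp (t * (inner ℝ w (direction V) - (1 - 1 / K) * inner ℝ w (direction U))) =
      ∏ i, ∏ j, Real.exp (θ i * (((V i j : ℤ) : ℝ) - (1 - 1 / K) * ((U i j : ℤ) : ℝ))) := by
    intro V
    simp only [← Real.exp_sum]
    congr 1
    simp only [inner_direction, Finset.mul_sum, ← Finset.sum_sub_distrib, θ]
    refine Finset.sum_congr rfl fun i _ => Finset.sum_congr rfl fun j _ => ?_
    ring
  simp only [hexp]
  rw [avg_correlatedCopy_prod K U fun i j v =>
    Real.exp (θ i * (((v : ℤ) : ℝ) - (1 - 1 / K) * ((U i j : ℤ) : ℝ)))]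
  calc _ ≤ ∏ i, ∏ _j : Fin k, Real.exp (2 * θ i ^ 2 / K) :=
        Finset.prod_le_prod (fun i _ => Finset.prod_nonneg fun j _ =>
          avg_nonneg _ fun _ => (Real.exp_pos _).le) fun i _ =>
          Finset.prod_le_prod (fun j _ => avg_nonneg _ fun _ => (Real.exp_pos _).le)
            fun j _ => correlatedSign_mgf_le hK _ (hθ i)
    _ = Real.exp (2 * t ^ 2 * ‖w‖ ^ 2 / K) := by
        simp only [← Real.exp_sum]
        congr 1
        rw [← sum_sum_sq_div_sqrt hk w]
        simp only [Finset.mul_sum, Finset.sum_div, θ]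
        refine Finset.sum_congr rfl fun i _ => Finset.sum_congr rfl fun j _ => ?_
        ring

lemma randomMatrix_mgf_le {d k : ℕ} (hk : 1 ≤ k) (w : EuclideanSpace ℝ (Fin d)) (t : ℝ) :
    ((randomMatrix d k).avg fun U => Real.exp (t * inner ℝ w (direction U))) ≤
      Real.exp (t ^ 2 * ‖w‖ ^ 2 / 2) := by
  have hexp : ∀ V : SignMatrix d k, Real.exp (t * inner ℝ w (direction V)) =
      ∏ i, ∏ j, Real.exp (t * (w i / √(k : ℝ)) * ((V i j : ℤ) : ℝ)) := by
    intro V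
    simp only [← Real.exp_sum]
    congr 1
    simp only [inner_direction, Finset.mul_sum, mul_assoc]
  simp only [hexp]
  rw [avg_randomMatrix_prod fun i j v => Real.exp (t * (w i / √(k : ℝ)) * ((v : ℤ) : ℝ))]
  calc _ ≤ ∏ i, ∏ _j : Fin k, Real.exp ((t * (w i / √(k : ℝ))) ^ 2 / 2) := by
        refine Finset.prod_le_prod (fun i _ => Finset.prod_nonneg fun j _ =>
          avg_nonneg _ fun _ => (Real.exp_pos _).le) fun i _ =>
          Finset.prod_le_prod (fun j _ => avg_nonneg _ fun _ => (Real.exp_pos _).le) fun j _ => ?_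
        refine le_trans (le_of_eq ?_) (Real.cosh_le_exp_half_sq _)
        rw [avg_randomSign, Real.cosh_eq]
        simp
    _ = Real.exp (t ^ 2 * ‖w‖ ^ 2 / 2) := by
        simp only [← Real.exp_sum]
        congr 1
        rw [← sum_sum_sq_div_sqrt hk w]
        simp only [Finset.mul_sum, Finset.sum_div]
        refine Finset.sum_congr rfl fun i _ => Finset.sum_congr rfl fun j _ => ?_
        ring

lemma randomMatrix_tail_le {d k : ℕ} (hk : 1 ≤ k) (w : EuclideanSpace ℝ (Fin d)) {θ L : ℝ}
    (hθ : 0 ≤ θ) (hL : 0 < L) (hw : ‖w‖ ^ 2 ≤ L) :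
    ((randomMatrix d k).avg fun U => if θ ≤ inner ℝ w (direction U) then (1 : ℝ) else 0) ≤
      Real.exp (-(θ ^ 2 / (2 * L))) := by
  have ht : 0 ≤ θ / L := by positivity
  calc _ ≤ (randomMatrix d k).avg fun U =>
        Real.exp (-(θ / L * θ)) * Real.exp (θ / L * inner ℝ w (direction U)) := by
        refine avg_mono _ fun U => ?_
        rw [← Real.exp_add]
        split_ifs with h
        · exact Real.one_le_exp (by nlinarith)
        · positivity
    _ ≤ Real.exp (-(θ / L * θ)) * Real.exp ((θ / L) ^ 2 * L / 2) := by
        rw [avg_const_mul]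
        gcongr
        refine (randomMatrix_mgf_le hk w _).trans ?_
        gcongr
    _ = _ := by
        rw [← Real.exp_add]
        congr 1
        field_simp
        ring

/-! ### Chains in random matchings: survival and comparison -/

/-- `e` is the indicator function of a set with at most one element. -/
def IsSubsingleIndicator {ι : Type} (e : ι → ℝ) : Prop :=
  (∀ y, e y = 0) ∨ ∃ z, e z = 1 ∧ ∀ y, y ≠ z → e y = 0

namespace IsSubsingleIndicator

variable {ι : Type} {e : ι → ℝ}

lemma nonneg (he : IsSubsingleIndicator e) (y : ι) : 0 ≤ e y := by
  classical
  rcases he with h | ⟨z, hz, h⟩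
  · exact (h y).ge
  · by_cases hy : y = z
    · rw [hy, hz]; exact zero_le_one
    · exact (h y hy).ge

lemma sum_mul_cases [Fintype ι] (he : IsSubsingleIndicator e) :
    (∀ a : ι → ℝ, ∑ y, e y * a y = 0) ∨ ∃ z, e z = 1 ∧ ∀ a : ι → ℝ, ∑ y, e y * a y = a z := by
  rcases he with h | ⟨z, hz, h⟩
  · exact .inl fun a => by simp [h]
  · refine .inr ⟨z, hz, fun a => ?_⟩
    rw [Finset.sum_eq_single z (fun y _ hy => by rw [h y hy, zero_mul]) (by simp), hz, one_mul]

/-- Powers pass inside sums over neighbours because a matching leaves at most one term; the survival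
recursion relies on this. -/
lemma sum_mul_rpow [Fintype ι] (he : IsSubsingleIndicator e) (a : ι → ℝ) {s : ℝ} (hs : s ≠ 0) :
    (∑ y, e y * a y) ^ s = ∑ y, e y * a y ^ s := by
  rcases he.sum_mul_cases with h | ⟨z, -, h⟩
  · rw [h, h, Real.zero_rpow hs]
  · rw [h, h]

lemma sum_mul_le [Fintype ι] (he : IsSubsingleIndicator e) {a : ι → ℝ} {c : ℝ} (hc : 0 ≤ c)
    (ha : ∀ y, e y ≠ 0 → a y ≤ c) : ∑ y, e y * a y ≤ c := by
  rcases he.sum_mul_cases with h | ⟨z, hz, h⟩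
  · rwa [h]
  · rw [h]; exact ha z (by simp [hz])

end IsSubsingleIndicator

/-- Jensen for the convex map `y ↦ y^K`, proved through its tangent line at `c`, which is
Bernoulli's inequality. -/
lemma pow_mul_card_le_sum_avg {ι β : Type} {K : ℕ} (hK : 1 ≤ K) (μ : RandProg β) (X : Finset ι)
    (F : ι → β → ℝ) (hF : ∀ x V, 0 ≤ F x V) {c : ℝ} (hc : 0 < c)
    (h : c * X.card ≤ ∑ x ∈ X, μ.avg fun V => F x V ^ (1 / K : ℝ)) :
    c ^ K * X.card ≤ ∑ x ∈ X, μ.avg (F x) := by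
  have hK' : (0 : ℝ) < K := by exact_mod_cast hK
  obtain ⟨m, rfl⟩ : ∃ m, K = m + 1 := ⟨K - 1, by lia⟩
  set s : ℝ := 1 / ((m + 1 : ℕ) : ℝ)
  set b : ℝ := ((m + 1 : ℕ) : ℝ) * c ^ m
  have hpt : ∀ x V, c ^ (m + 1) + (b * F x V ^ s + -(b * c)) ≤ F x V := by
    intro x V
    have hy : 0 ≤ F x V ^ s := Real.rpow_nonneg (hF x V) _
    have hpow : (F x V ^ s) ^ (m + 1) = F x V := by
      rw [← Real.rpow_natCast, ← Real.rpow_mul (hF x V), one_div_mul_cancel hK'.ne', Real.rpow_one]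
    have hb := one_add_mul_le_pow (a := F x V ^ s / c - 1)
      (by have := div_nonneg hy hc.le; linarith) (m + 1)
    rw [add_sub_cancel, div_pow, hpow, le_div_iff₀ (by positivity)] at hb
    refine le_trans (le_of_eq ?_) hb
    simp only [b]
    field_simp
    ring
  calc c ^ (m + 1) * X.card ≤ c ^ (m + 1) * X.card +
        b * ((∑ x ∈ X, μ.avg fun V => F x V ^ s) - c * X.card) := by
        have : 0 ≤ b * ((∑ x ∈ X, μ.avg fun V => F x V ^ s) - c * X.card) :=
          mul_nonneg (by positivity) (by linarith)
        linarith
    _ = ∑ x ∈ X, μ.avg fun V => c ^ (m + 1) + (b * F x V ^ s + -(b * c)) := by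
        simp only [avg_add, avg_const, avg_const_mul, Finset.sum_add_distrib, Finset.sum_const,
          nsmul_eq_mul, ← Finset.mul_sum]
        ring
    _ ≤ _ := Finset.sum_le_sum fun x _ => avg_mono _ (hpt x)

section Chains

variable {ι β : Type} [Fintype ι]

/-- The expected sum of `g` over the ends of the chains of length `m` that start at a vertex and
use the directed edges `E` at the successive states of the chain with kernel `κ`. -/
noncomputable def chainSum (κ : β → RandProg β) (E : β → ι → ι → ℝ) (g : ι → β → ℝ) :
    ℕ → ι → β → ℝ
  | 0, z, U => g z U
  | m + 1, z, U => (κ U).avg fun V => ∑ y, E V z y * chainSum κ E g m y V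

/-- The expected number of prefixes, of length at least one, of the chain of length at most `m`
that end in a vertex marked by `l`. -/
noncomputable def markedSum (κ : β → RandProg β) (E : β → ι → ι → ℝ) (l : ι → ℝ) :
    ℕ → ι → β → ℝ
  | 0, _, _ => 0
  | m + 1, z, U => (κ U).avg fun V => ∑ y, E V z y * (l y + markedSum κ E l m y V)

variable {κ : β → RandProg β} {E E' : β → ι → ι → ℝ}

lemma chainSum_nonneg (hE : ∀ V x y, 0 ≤ E V x y) {g : ι → β → ℝ} (hg : ∀ y V, 0 ≤ g y V) (m : ℕ)
    (z : ι) (U : β) : 0 ≤ chainSum κ E g m z U := by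
  induction m generalizing z U with
  | zero => exact hg z U
  | succ m ih =>
    exact avg_nonneg _ fun V => Finset.sum_nonneg fun y _ => mul_nonneg (hE V z y) (ih y V)

lemma chainSum_mono (hE : ∀ V x y, 0 ≤ E V x y) (hEE' : ∀ V x y, E V x y ≤ E' V x y)
    {g g' : ι → β → ℝ} (hg : ∀ y V, 0 ≤ g y V) (hgg' : ∀ y V, g y V ≤ g' y V) (m : ℕ)
    (z : ι) (U : β) : chainSum κ E g m z U ≤ chainSum κ E' g' m z U := by
  induction m generalizing z U with
  | zero => exact hgg' z U
  | succ m ih =>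
    exact avg_mono _ fun V => Finset.sum_le_sum fun y _ =>
      mul_le_mul (hEE' V z y) (ih y V) (chainSum_nonneg hE hg m y V)
        ((hE V z y).trans (hEE' V z y))

/-- Used with `p` the condition of being near the start, so that end weights need only be compared
at near vertices. -/
lemma chainSum_mono_of_mem (hE : ∀ V x y, 0 ≤ E V x y) {p : ι → Prop}
    (hp : ∀ V x y, E V x y ≠ 0 → p y) {g g' : ι → β → ℝ} (hgg' : ∀ y V, p y → g y V ≤ g' y V)
    (m : ℕ) (z : ι) (hz : p z) (U : β) : chainSum κ E g m z U ≤ chainSum κ E g' m z U := by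
  induction m generalizing z U with
  | zero => exact hgg' z U hz
  | succ m ih =>
    refine avg_mono _ fun V => Finset.sum_le_sum fun y _ => ?_
    by_cases hy : E V z y = 0
    · simp [hy]
    · exact mul_le_mul_of_nonneg_left (ih y (hp V z y hy) V) (hE V z y)

lemma chainSum_add (g g' : ι → β → ℝ) (m : ℕ) (z : ι) (U : β) :
    chainSum κ E (fun y V => g y V + g' y V) m z U =
      chainSum κ E g m z U + chainSum κ E g' m z U := by
  induction m generalizing z U with
  | zero => rfl
  | succ m ih => simp only [chainSum, ih, mul_add, Finset.sum_add_distrib, avg_add]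

lemma markedSum_nonneg (hE : ∀ V x y, 0 ≤ E V x y) {l : ι → ℝ} (hl : ∀ y, 0 ≤ l y) (m : ℕ)
    (z : ι) (U : β) : 0 ≤ markedSum κ E l m z U := by
  induction m generalizing z U with
  | zero => exact le_rfl
  | succ m ih =>
    exact avg_nonneg _ fun V => Finset.sum_nonneg fun y _ =>
      mul_nonneg (hE V z y) (add_nonneg (hl y) (ih y V))

lemma chainSum_one_le_one (hE : ∀ V x, IsSubsingleIndicator (E V x)) (m : ℕ) (z : ι) (U : β) :
    chainSum κ E (fun _ _ => 1) m z U ≤ 1 := by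
  induction m generalizing z U with
  | zero => exact le_rfl
  | succ m ih =>
    refine (avg_mono _ fun V => (hE V z).sum_mul_le zero_le_one fun y _ => ih y V).trans_eq ?_
    exact avg_const _ _

/-- A chain either meets a marked vertex or never uses one. -/
lemma chainSum_mul_le_marked (hE : ∀ V x, IsSubsingleIndicator (E V x)) {l : ι → ℝ}
    (hl : ∀ y, l y = 0 ∨ l y = 1) (m : ℕ) (V : β) (z y : ι) :
    E V z y * chainSum κ E (fun _ _ => 1) m y V ≤
      E V z y * (l y + markedSum κ E l m y V) + E V z y * (1 - l y) *
        chainSum κ (fun V z y => E V z y * (1 - l y)) (fun _ _ => 1) m y V := by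
  have hl0 : ∀ y, 0 ≤ l y := fun y => by rcases hl y with h | h <;> simp [h]
  -- Split at the first marked vertex: its prefix already contributes `1`, while the continuation
  -- has total weight at most `1`.
  have key : ∀ m y V, l y = 0 → chainSum κ E (fun _ _ => 1) m y V ≤ markedSum κ E l m y V +
      chainSum κ (fun V z y => E V z y * (1 - l y)) (fun _ _ => 1) m y V := by
    intro m
    induction m with
    | zero => intro y V _; simp [chainSum, markedSum]
    | succ m ih =>
      intro y V _
      simp only [chainSum, markedSum, ← avg_add, ← Finset.sum_add_distrib]
      refine avg_mono _ fun W => Finset.sum_le_sum fun x _ => ?_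
      have h0 := (hE W y).nonneg x
      rcases hl x with h | h
      · have := mul_le_mul_of_nonneg_left (ih x W h) h0
        rw [h, sub_zero, mul_one, zero_add]
        linarith
      · have h1 := mul_le_mul_of_nonneg_left (chainSum_one_le_one (κ := κ) hE m x W) h0
        have h2 := mul_nonneg h0 (markedSum_nonneg (κ := κ) (fun V x => (hE V x).nonneg) hl0 m x W)
        rw [h]
        linarith
  have h0 := (hE V z).nonneg y
  rcases hl y with h | h
  · have := mul_le_mul_of_nonneg_left (key m y V h) h0
    rw [h, sub_zero, mul_one, zero_add]
    linarith
  · have h1 := mul_le_mul_of_nonneg_left (chainSum_one_le_one (κ := κ) hE m y V) h0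
    have h2 := mul_nonneg h0 (markedSum_nonneg (κ := κ) (fun V x => (hE V x).nonneg) hl0 m y V)
    rw [h]
    linarith

/-- A union bound over ends: from each start at most one chain follows a given sequence of states,
so its end weight is at most the sum of `g` over all vertices at the last state. By stationarity
that state again has distribution `μ`. -/
lemma avg_chainSum_le {μ : RandProg β} (hμ : Stationary μ κ)
    (hE : ∀ V x, IsSubsingleIndicator (E V x)) {g : ι → β → ℝ} (hg : ∀ y V, 0 ≤ g y V) (m : ℕ)
    (x : ι) : (μ.avg fun V => ∑ y, E V x y * chainSum κ E g m y V) ≤ μ.avg fun V => ∑ y, g y V := by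
  let T : (β → ℝ) → β → ℝ := fun F U => (κ U).avg F
  let G : β → ℝ := fun V => ∑ y, g y V
  have hG : ∀ V, 0 ≤ G V := fun V => Finset.sum_nonneg fun y _ => hg y V
  have h0 : ∀ m U, 0 ≤ T^[m] G U := by
    intro m
    induction m with
    | zero => exact hG
    | succ m ih => intro U; rw [Function.iterate_succ_apply']; exact avg_nonneg _ ih
  have h1 : ∀ m z U, chainSum κ E g m z U ≤ T^[m] G U := by
    intro m
    induction m with
    | zero => exact fun z U =>
        Finset.single_le_sum (f := fun y => g y U) (fun y _ => hg y U) (Finset.mem_univ z)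
    | succ m ih =>
      intro z U
      rw [Function.iterate_succ_apply']
      exact avg_mono _ fun V => (hE V z).sum_mul_le (h0 m V) fun y _ => ih y V
  have h2 : ∀ m, μ.avg (T^[m] G) = μ.avg G := by
    intro m
    induction m with
    | zero => rfl
    | succ m ih => rw [Function.iterate_succ_apply', ← ih]; exact hμ _
  rw [← h2 m]
  exact avg_mono _ fun V => (hE V x).sum_mul_le (h0 m V) fun y _ => h1 m y V

/-- Chains in a graph all of whose vertices have degree at least `η` survive. -/
lemma le_sum_avg_chainSum_rpow {K : ℕ} (hK : 1 ≤ K) {μ : RandProg β}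
    (hμ : ReverseHypercontractive K μ κ) (hE : ∀ V x, IsSubsingleIndicator (E V x))
    {X : Finset ι} (hX : ∀ V x y, y ∉ X → E V x y = 0) (hX' : ∀ V x y, x ∉ X → E V x y = 0)
    (hcol : ∀ V y, ∑ x, E V x y ≤ 1) {η : ℝ} (hη0 : 0 ≤ η) (hη1 : η ≤ 1)
    (hout : ∀ x ∈ X, η ≤ μ.avg fun V => ∑ y, E V x y)
    (hin : ∀ y ∈ X, η ≤ μ.avg fun V => ∑ x, E V x y) (m : ℕ) :
    η ^ (2 * (m + 1)) * X.card ≤ ∑ x ∈ X, μ.avg fun V =>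
      (∑ y, E V x y * chainSum κ E (fun _ _ => 1) m y V) ^ (1 / K : ℝ) := by
  have hs : (1 / K : ℝ) ≠ 0 := by
    have : (0 : ℝ) < K := by exact_mod_cast hK
    positivity
  have h0 := fun V x => (hE V x).nonneg
  induction m with
  | zero =>
    simp only [chainSum, mul_one]
    calc η ^ (2 * (0 + 1)) * X.card = ∑ _x ∈ X, η ^ 2 := by simp [mul_comm]
      _ ≤ _ := by
        refine Finset.sum_le_sum fun x hx => ?_
        have e : ∀ V, (∑ y, E V x y) ^ (1 / K : ℝ) = ∑ y, E V x y := fun V => by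
          simpa using (hE V x).sum_mul_rpow (fun _ => 1) hs
        simp only [e]
        nlinarith [hout x hx]
  | succ m ih =>
    set D := chainSum κ E (fun _ _ => 1)
    have hD0 : ∀ m y V, 0 ≤ D m y V := chainSum_nonneg h0 fun _ _ => zero_le_one
    calc η ^ (2 * (m + 1 + 1)) * X.card = η ^ 2 * (η ^ (2 * (m + 1)) * X.card) := by ring
      _ ≤ η ^ 2 * ∑ y ∈ X, μ.avg fun V => (∑ x, E V y x * D m x V) ^ (1 / K : ℝ) := by gcongr
      -- Reverse hypercontractivity joins the edge entering `y` at one state to the chain leaving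
      -- `y` at the next. The squared average of `√h` is at least the squared in-degree `η²`.
      _ ≤ ∑ y ∈ X, μ.avg fun V => (∑ x, E V x y) * D (m + 1) y V ^ (1 / K : ℝ) := by
        rw [Finset.mul_sum]
        refine Finset.sum_le_sum fun y hy => ?_
        refine le_trans ?_ (hμ (fun V => ∑ x, E V x y) (fun V => ∑ x, E V y x * D m x V)
          (fun V => Finset.sum_nonneg fun x _ => h0 V x y)
          fun V => Finset.sum_nonneg fun x _ => mul_nonneg (h0 V y x) (hD0 m x V))
        gcongr
        · exact avg_nonneg _ fun V => Real.rpow_nonneg (Finset.sum_nonneg fun x _ =>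
            mul_nonneg (h0 V y x) (hD0 m x V)) _
        · refine (hin y hy).trans (avg_mono _ fun V => ?_)
          have a0 : 0 ≤ ∑ x, E V x y := Finset.sum_nonneg fun x _ => h0 V x y
          exact Real.le_sqrt_of_sq_le (by nlinarith [hcol V y])
      -- Regroup the same chains by their first vertex `x` instead of their second vertex `y`.
      _ = ∑ x ∈ X, μ.avg fun V => (∑ y, E V x y * D (m + 1) y V) ^ (1 / K : ℝ) := by
        simp only [(hE _ _).sum_mul_rpow _ hs, ← avg_sum, Finset.sum_mul]
        congr 1
        funext V
        have e1 : ∀ y, ∑ x, E V x y * D (m + 1) y V ^ (1 / K : ℝ) =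
            ∑ x ∈ X, E V x y * D (m + 1) y V ^ (1 / K : ℝ) := fun y =>
          (Finset.sum_subset (Finset.subset_univ X) fun x _ hx => by simp [hX' V x y hx]).symm
        have e2 : ∀ x, ∑ y, E V x y * D (m + 1) y V ^ (1 / K : ℝ) =
            ∑ y ∈ X, E V x y * D (m + 1) y V ^ (1 / K : ℝ) := fun x =>
          (Finset.sum_subset (Finset.subset_univ X) fun y _ hy => by simp [hX V x y hy]).symm
        simp only [e1, e2]
        exact Finset.sum_comm

/-- A weighted graph of average degree `δ` has an induced subgraph of minimum degree `δ / 4`. -/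
lemma exists_subset_min_degree (w : ι → ι → ℝ) (hsymm : ∀ x y, w x y = w y x)
    (hdiag : ∀ x, w x x = 0) {δ : ℝ} (hδ0 : 0 ≤ δ)
    (hδ : δ * Fintype.card ι ≤ ∑ x, ∑ y, w x y) :
    ∃ X : Finset ι, δ / 2 * Fintype.card ι ≤ ∑ x ∈ X, ∑ y ∈ X, w x y ∧
      ∀ x ∈ X, δ / 4 ≤ ∑ y ∈ X, w x y := by
  classical
  -- For a maximizer, deleting a vertex loses twice its degree and gains `δ/2`, so each degree is at
  -- least `δ/4`.
  obtain ⟨X, -, hX⟩ := Finset.exists_max_image (Finset.univ : Finset (Finset ι))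
    (fun X => (∑ x ∈ X, ∑ y ∈ X, w x y) - δ / 2 * X.card) ⟨∅, Finset.mem_univ _⟩
  refine ⟨X, ?_, fun x hx => ?_⟩
  · have h := hX Finset.univ (Finset.mem_univ _)
    rw [Finset.card_univ] at h
    have : 0 ≤ δ / 2 * X.card := by positivity
    linarith
  · have h := hX (X.erase x) (Finset.mem_univ _)
    have hcard : ((X.erase x).card : ℝ) = X.card - 1 := by
      rw [← Finset.card_erase_add_one hx]
      push_cast
      ring
    have hrow : ∀ y, ∑ z ∈ X, w y z = w y x + ∑ z ∈ X.erase x, w y z := fun y =>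
      (Finset.add_sum_erase X (w y) hx).symm
    have hsum : ∑ y ∈ X, ∑ z ∈ X, w y z =
        2 * ∑ z ∈ X, w x z + ∑ y ∈ X.erase x, ∑ z ∈ X.erase x, w y z := by
      rw [← Finset.add_sum_erase X _ hx]
      simp only [hrow, Finset.sum_add_distrib, hdiag]
      simp only [hsymm _ x]
      ring
    rw [hcard, hsum] at h
    linarith

end Chains

/-! ### Drift along chains that stay near their start -/

/-- Chains all of whose vertices are near `x` and whose steps have stretch `σ` rarely end with
small stretch. -/
lemma chainSum_exp_le {ι : Type} [Fintype ι] {d k K : ℕ} (hK : 1 ≤ K) (hk : 1 ≤ k)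
    {E : SignMatrix d k → ι → ι → ℝ} (hE : ∀ V x, IsSubsingleIndicator (E V x))
    (v : ι → EuclideanSpace ℝ (Fin d)) {σ L t c θ : ℝ} (x : ι) (hσ : 0 ≤ σ) (ht : 0 ≤ t)
    (htL : t ^ 2 * L ≤ k / 4)
    (hstretch : ∀ V y z, E V y z ≠ 0 → σ ≤ inner ℝ (v z - v y) (direction V))
    (hshort : ∀ V y z, E V y z ≠ 0 → ‖v z - v x‖ ^ 2 ≤ L) (m : ℕ)
    (hc : ∀ i ≤ m, c ≤ (1 - 1 / K : ℝ) ^ i) (z : ι) (hz : ‖v z - v x‖ ^ 2 ≤ L)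
    (U : SignMatrix d k) :
    chainSum (correlatedCopy K) E
        (fun y V => Real.exp (t * (θ - inner ℝ (v y - v x) (direction V)))) m z U ≤
      Real.exp (t * θ + m * (2 * t ^ 2 * L / K - t * σ * c) -
        t * (1 - 1 / K) ^ m * inner ℝ (v z - v x) (direction U)) := by
  have hK' : (1 : ℝ) ≤ K := by exact_mod_cast hK
  have hρ0 : (0 : ℝ) ≤ 1 - 1 / K := by
    rw [sub_nonneg, div_le_one (by positivity)]; exact hK'
  have hρ1 : (1 : ℝ) - 1 / K ≤ 1 := by
    have : (0 : ℝ) ≤ 1 / K := by positivity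
    linarith
  induction m generalizing z U with
  | zero =>
    simp only [chainSum]
    refine (congrArg Real.exp ?_).le
    push_cast
    ring
  | succ m ih =>
    set ρ : ℝ := 1 - 1 / K
    set P : ι → SignMatrix d k → ℝ := fun y V => inner ℝ (v y - v x) (direction V)
    set B : ℝ := 2 * t ^ 2 * L / K
    have hρm : ρ ^ m ≤ 1 := pow_le_one₀ hρ0 hρ1
    have hρm0 : 0 ≤ ρ ^ m := pow_nonneg hρ0 m
    -- The weight `ρ ^ m` is the factor by which a projection shrinks in mean over the `m` remaining
    -- steps. The edge gains at least `σ`, worth at least `t * σ * c` after shrinking; what is left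
    -- is the centred noise of one resampling.
    have hstep : ∀ V, ∑ y, E V z y * chainSum (correlatedCopy K) E
        (fun y V => Real.exp (t * (θ - P y V))) m y V ≤
        Real.exp (t * θ + m * (B - t * σ * c) - t * σ * c - t * ρ ^ (m + 1) * P z U) *
          Real.exp (-(t * ρ ^ m) * (P z V - ρ * P z U)) := by
      intro V
      refine (hE V z).sum_mul_le (by positivity) fun y hy => ?_
      refine (ih (fun i hi => hc i (by lia)) y (hshort V z y hy) V).trans ?_
      rw [← Real.exp_add]
      refine Real.exp_le_exp.2 ?_
      have h1 : P y V = inner ℝ (v y - v z) (direction V) + P z V := by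
        simp only [P, ← inner_add_left]
        congr 1
        abel
      have h2 := hstretch V z y hy
      have h3 : t * ρ ^ m * σ ≤ t * ρ ^ m * inner ℝ (v y - v z) (direction V) := by gcongr
      have h4 : t * c * σ ≤ t * ρ ^ m * σ := by
        gcongr
        exact hc m (by lia)
      rw [show inner ℝ (v y - v x) (direction V) = P y V from rfl, h1, pow_succ]
      linarith
    calc _ ≤ _ := avg_mono _ hstep
      _ ≤ Real.exp (t * θ + m * (B - t * σ * c) - t * σ * c - t * ρ ^ (m + 1) * P z U) *
          Real.exp B := by
        rw [avg_const_mul]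
        gcongr
        have ht2 : (-(t * ρ ^ m)) ^ 2 ≤ t ^ 2 := by
          rw [neg_sq]
          exact pow_le_pow_left₀ (by positivity) (by nlinarith) 2
        refine (correlatedCopy_mgf_le hK hk U (v z - v x) ?_).trans ?_
        · calc _ ≤ t ^ 2 * L := by gcongr
            _ ≤ _ := htL
        · simp only [B]
          gcongr
      _ = _ := by
        rw [← Real.exp_add]
        congr 1
        push_cast
        ring

lemma IsSubsingleIndicator.mul {ι : Type} {e a : ι → ℝ} (he : IsSubsingleIndicator e)
    (ha : ∀ y, a y = 0 ∨ a y = 1) : IsSubsingleIndicator fun y => e y * a y := by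
  rcases he with h | ⟨z, hz, h⟩
  · exact .inl fun y => by simp [h]
  · rcases ha z with h0 | h1
    · refine .inl fun y => ?_
      by_cases hy : y = z
      · simp [hy, h0]
      · simp [h y hy]
    · exact .inr ⟨z, by simp [hz, h1], fun y hy => by simp [h y hy]⟩

/-! ### Matching covers: surviving chains against short chains -/

/-- The adjacency matrix of a set of directed edges. -/
noncomputable def edgeWeight {n : ℕ} (S : Finset (Fin n × Fin n)) (x y : Fin n) : ℝ :=
  if (x, y) ∈ S then 1 else 0

namespace IsDirectedMatching

variable {n : ℕ} {S : Finset (Fin n × Fin n)}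

lemma isSubsingleIndicator (hS : IsDirectedMatching S) (x : Fin n) :
    IsSubsingleIndicator (edgeWeight S x) := by
  by_cases h : ∃ z, (x, z) ∈ S
  · obtain ⟨z, hz⟩ := h
    refine .inr ⟨z, if_pos hz, fun y hy => if_neg fun hxy => ?_⟩
    exact (hS.2 _ hxy _ hz fun e => hy (congrArg Prod.snd e)).1 rfl
  · exact .inl fun y => if_neg fun hy => h ⟨y, hy⟩

lemma two_mul_card_le (hS : IsDirectedMatching S) : 2 * S.card ≤ n := by
  have h1 : (S.image Prod.fst).card = S.card :=
    Finset.card_image_of_injOn fun e he f hf hef => by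
      by_contra hne
      exact (hS.2 e he f hf hne).1 hef
  have h2 : (S.image Prod.snd).card = S.card :=
    Finset.card_image_of_injOn fun e he f hf hef => by
      by_contra hne
      exact (hS.2 e he f hf hne).2.2.2 hef
  have h3 : Disjoint (S.image Prod.fst) (S.image Prod.snd) := by
    rw [Finset.disjoint_left]
    intro x hx hx'
    obtain ⟨e, he, rfl⟩ := Finset.mem_image.1 hx
    obtain ⟨f, hf, hfe⟩ := Finset.mem_image.1 hx'
    by_cases hef : e = f
    · exact hS.1 e he (by rw [← hfe, hef])
    · exact (hS.2 e he f hf hef).2.1 hfe.symm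
  have h4 := Finset.card_le_univ (S.image Prod.fst ∪ S.image Prod.snd)
  rw [Finset.card_union_of_disjoint h3, h1, h2, Fintype.card_fin] at h4
  lia

end IsDirectedMatching

lemma sum_sum_edgeWeight {n : ℕ} (S : Finset (Fin n × Fin n)) :
    ∑ x, ∑ y, edgeWeight S x y = S.card := by
  simp only [edgeWeight]
  rw [← Fintype.sum_prod_type (f := fun e : Fin n × Fin n => if e ∈ S then (1 : ℝ) else 0)]
  simp

namespace IsMatchingCover

variable {n d k : ℕ} {σ δ : ℝ} {v : Fin n → EuclideanSpace ℝ (Fin d)}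
  {M : EuclideanSpace ℝ (Fin d) → Finset (Fin n × Fin n)}

lemma le_avg_card (h : IsMatchingCover (directionLaw d k) σ δ v M) :
    δ * n ≤ (randomMatrix d k).avg fun U => ((M (direction U)).card : ℝ) := by
  have h0 := h.large
  have h1 : expectation (directionLaw d k) (fun u => ((M u).card : ℝ≥0∞)) =
      ENNReal.ofReal ((randomMatrix d k).avg fun U => ((M (direction U)).card : ℝ)) := by
    rw [directionLaw, PMF.map, expectation_bind, avg_randomMatrix,
      ← expectation_uniformOfFintype _ fun U => Nat.cast_nonneg _]
    simp only [Function.comp_apply, expectation_pure, ENNReal.ofReal_natCast]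
  rw [h1] at h0
  exact (ENNReal.ofReal_le_ofReal_iff (avg_nonneg _ fun U => Nat.cast_nonneg _)).1 h0

/-- A directed matching has at most `n/2` edges. The bound on `δ` later absorbs numerical factors
into powers of `δ`. -/
lemma le_half (h : IsMatchingCover (directionLaw d k) σ δ v M) (hn : 1 ≤ n) : δ ≤ 1 / 2 := by
  have hn' : (0 : ℝ) < n := by exact_mod_cast hn
  have h1 : ((randomMatrix d k).avg fun U => ((M (direction U)).card : ℝ)) ≤ 1 / 2 * n := by
    refine (avg_mono _ (g := fun _ => (1 / 2 : ℝ) * n) fun U => ?_).trans_eq (avg_const _ _)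
    have := (h.matching (direction U)).two_mul_card_le
    have h2 : (2 : ℝ) * (M (direction U)).card ≤ n := by exact_mod_cast this
    linarith
  exact le_of_mul_le_mul_right (h.le_avg_card.trans h1) hn'

/-- Chains of correlated directions survive with probability exponentially small in the square of
their length. -/
lemma le_sum_avg_chainSum (h : IsMatchingCover (directionLaw d k) σ δ v M) (hδ0 : 0 < δ)
    (hδ1 : δ ≤ 1) {K : ℕ} (hK : 1 ≤ K) (m : ℕ) :
    (δ / 4) ^ (2 * (m + 1) * K) * (δ / 2 * n) ≤ ∑ x, (randomMatrix d k).avg fun V =>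
      ∑ y, edgeWeight (M (direction V)) x y *
        chainSum (correlatedCopy K) (fun V => edgeWeight (M (direction V))) (fun _ _ => 1) m y V := by
  classical
  set μ := randomMatrix d k
  set E : SignMatrix d k → Fin n → Fin n → ℝ := fun V => edgeWeight (M (direction V))
  have hE : ∀ V x, IsSubsingleIndicator (E V x) := fun V x => (h.matching _).isSubsingleIndicator x
  have hneg : ∀ V x y, E (-V) x y = E V y x := by
    intro V x y
    simp only [E, edgeWeight, direction_neg, h.skew (direction V) y x]
  have hrow : ∀ V x, ∑ y, E V x y ≤ 1 := fun V x => by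
    simpa using (hE V x).sum_mul_le (a := fun _ => 1) zero_le_one fun _ _ => le_rfl
  let w : Fin n → Fin n → ℝ := fun x y => μ.avg fun V => E V x y
  -- `U` and `-U` are equally distributed, and negation reverses the edges of the cover.
  have hw : ∀ x y, w x y = w y x := fun x y => by
    simp only [w]
    rw [← avg_randomMatrix_neg]
    simp only [hneg]
    rfl
  have hw0 : ∀ x y, 0 ≤ w x y := fun x y => avg_nonneg _ fun V => (hE V x).nonneg y
  have hdiag : ∀ x, w x x = 0 := fun x => by
    have : ∀ V, E V x x = 0 := fun V => if_neg fun hx => (h.matching _).1 _ hx rfl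
    simp [w, this]
  obtain ⟨X, hX1, hX2⟩ := exists_subset_min_degree w hw hdiag hδ0.le (by
    have := h.le_avg_card
    simp only [← sum_sum_edgeWeight, avg_sum] at this
    simpa using this)
  have hcard : δ / 2 * n ≤ X.card := by
    rw [Fintype.card_fin] at hX1
    refine hX1.trans ?_
    calc ∑ x ∈ X, ∑ y ∈ X, w x y ≤ ∑ _x ∈ X, (1 : ℝ) := by
          refine Finset.sum_le_sum fun x _ => ?_
          calc ∑ y ∈ X, w x y ≤ ∑ y, w x y :=
                Finset.sum_le_sum_of_subset_of_nonneg (Finset.subset_univ X) fun y _ _ => hw0 x y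
            _ ≤ 1 := by
                simp only [w, ← avg_sum]
                exact (avg_mono _ fun V => hrow V x).trans_eq (avg_const _ _)
      _ = X.card := by simp
  let i : Fin n → ℝ := fun x => if x ∈ X then 1 else 0
  have hi : ∀ x, i x = 0 ∨ i x = 1 := fun x => by by_cases hx : x ∈ X <;> simp [i, hx]
  have hi0 : ∀ x, x ∉ X → i x = 0 := fun x hx => if_neg hx
  have hi1 : ∀ x, x ∈ X → i x = 1 := fun x hx => if_pos hx
  have hi2 : ∀ x y, i x * i y = 0 ∨ i x * i y = 1 := fun x y => by
    rcases hi x with hx | hx <;> rcases hi y with hy | hy <;> simp [hx, hy]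
  let E' : SignMatrix d k → Fin n → Fin n → ℝ := fun V x y => E V x y * (i x * i y)
  have hE' : ∀ V x, IsSubsingleIndicator (E' V x) := fun V x => (hE V x).mul fun y => hi2 x y
  have hEE' : ∀ V x y, E' V x y ≤ E V x y := fun V x y => by
    have := (hE V x).nonneg y
    rcases hi2 x y with h | h <;> simp [E', h, this]
  have hdeg : ∀ x ∈ X, δ / 4 ≤ μ.avg fun V => ∑ y, E' V x y := by
    intro x hx
    refine (hX2 x hx).trans_eq ?_
    simp only [avg_sum, E', avg_mul_const]
    rw [← Finset.sum_subset (Finset.subset_univ X) fun y _ hy => by simp [hi0 y hy]]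
    exact Finset.sum_congr rfl fun y hy => by simp [w, hi1 x hx, hi1 y hy]
  have hneg' : ∀ V x y, E' (-V) x y = E' V y x := fun V x y => by
    simp only [E', hneg, mul_comm (i x)]
  have hs := le_sum_avg_chainSum_rpow hK (reverseHypercontractive_correlatedCopy hK d k) hE'
    (X := X) (fun V x y hy => by simp [E', hi0 y hy]) (fun V x y hx => by simp [E', hi0 x hx])
    (fun V y => by
      have := (Finset.sum_le_sum fun x (_ : x ∈ Finset.univ) => hEE' (-V) y x).trans (hrow (-V) y)
      simpa only [hneg'] using this)
    (by positivity : 0 ≤ δ / 4) (by linarith) hdeg (fun y hy => by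
      have := hdeg y hy
      rw [← avg_randomMatrix_neg] at this
      simpa only [hneg'] using this) m
  have hnn : ∀ x V, 0 ≤ ∑ y, E' V x y * chainSum (correlatedCopy K) E' (fun _ _ => 1) m y V :=
    fun x V => Finset.sum_nonneg fun y _ => mul_nonneg ((hE' V x).nonneg y)
      (chainSum_nonneg (fun V x => (hE' V x).nonneg) (fun _ _ => zero_le_one) m y V)
  have hs2 := pow_mul_card_le_sum_avg hK μ X
    (fun x V => ∑ y, E' V x y * chainSum (correlatedCopy K) E' (fun _ _ => 1) m y V) hnn
    (by positivity) hs
  rw [← pow_mul] at hs2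
  calc (δ / 4) ^ (2 * (m + 1) * K) * (δ / 2 * n)
      ≤ (δ / 4) ^ (2 * (m + 1) * K) * X.card := by gcongr
    _ ≤ _ := hs2
    _ ≤ ∑ x, μ.avg fun V => ∑ y, E' V x y * chainSum (correlatedCopy K) E' (fun _ _ => 1) m y V :=
        Finset.sum_le_sum_of_subset_of_nonneg (Finset.subset_univ X) fun x _ _ =>
          avg_nonneg _ (hnn x)
    _ ≤ _ := by
        refine Finset.sum_le_sum fun x _ => avg_mono _ fun V => Finset.sum_le_sum fun y _ => ?_
        exact mul_le_mul (hEE' V x y) (chainSum_mono (fun V x => (hE' V x).nonneg) hEE'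
          (fun _ _ => zero_le_one) (fun _ _ => le_rfl) m y V)
          (chainSum_nonneg (fun V x => (hE' V x).nonneg) (fun _ _ => zero_le_one) m y V)
          ((hE V x).nonneg y)

/-- Few of the chains that stay near their starting point survive. -/
lemma avg_short_chainSum_le (h : IsMatchingCover (directionLaw d k) σ δ v M) (hσ : 0 ≤ σ)
    {K : ℕ} (hK : 1 ≤ K) (hk : 1 ≤ k) {m : ℕ} (hmK : m ≤ K) {t L c θ : ℝ} (ht : 0 ≤ t)
    (hL : 0 < L) (hθ : 0 ≤ θ) (htL : t ^ 2 * L ≤ k / 4)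
    (hc : ∀ i ≤ m, c ≤ (1 - 1 / K : ℝ) ^ i) (x : Fin n) (l : Fin n → ℝ)
    (hl : ∀ y, l y = 0 ∨ l y = 1) (hshort : ∀ y, l y = 0 → ‖v y - v x‖ ^ 2 ≤ L) :
    ((randomMatrix d k).avg fun V => ∑ y, edgeWeight (M (direction V)) x y * (1 - l y) *
      chainSum (correlatedCopy K) (fun V z y => edgeWeight (M (direction V)) z y * (1 - l y))
        (fun _ _ => 1) m y V) ≤
      Real.exp (t * θ - (m + 1) * (t * σ * c) + 2 * t ^ 2 * L) +
        n * Real.exp (-(θ ^ 2 / (2 * L))) := by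
  have hK' : (0 : ℝ) < K := by exact_mod_cast hK
  have hl' : ∀ y, 1 - l y = 0 ∨ 1 - l y = 1 := fun y => by rcases hl y with h | h <;> simp [h]
  set μ := randomMatrix d k
  set E : SignMatrix d k → Fin n → Fin n → ℝ := fun V z y =>
    edgeWeight (M (direction V)) z y * (1 - l y) with hEdef
  have hE : ∀ V x, IsSubsingleIndicator (E V x) := fun V x =>
    ((h.matching _).isSubsingleIndicator x).mul hl'
  have hE0 := fun V x => (hE V x).nonneg
  have hne : ∀ V y z, E V y z ≠ 0 → (y, z) ∈ M (direction V) ∧ l z = 0 := by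
    intro V y z hyz
    constructor
    · by_contra hh
      exact hyz (by simp [E, edgeWeight, hh])
    · rcases hl z with hz | hz
      · exact hz
      · exact absurd (by simp [E, hz]) hyz
  have hstretch : ∀ V y z, E V y z ≠ 0 → σ ≤ inner ℝ (v z - v y) (direction V) :=
    fun V y z hyz => h.stretch _ _ _ (hne V y z hyz).1
  have hsh : ∀ V y z, E V y z ≠ 0 → ‖v z - v x‖ ^ 2 ≤ L :=
    fun V y z hyz => hshort z (hne V y z hyz).2
  let P : Fin n → SignMatrix d k → ℝ := fun y V => inner ℝ (v y - v x) (direction V)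
  let g₁ : Fin n → SignMatrix d k → ℝ := fun y V => Real.exp (t * (θ - P y V))
  let g₂ : Fin n → SignMatrix d k → ℝ := fun y V =>
    if θ ≤ P y V ∧ ‖v y - v x‖ ^ 2 ≤ L then 1 else 0
  have hg₂ : ∀ y V, 0 ≤ g₂ y V := fun y V => by simp only [g₂]; split_ifs <;> norm_num
  have b1 : (μ.avg fun V => ∑ y, E V x y * chainSum (correlatedCopy K) E g₁ m y V) ≤
      Real.exp (t * θ - (m + 1) * (t * σ * c) + 2 * t ^ 2 * L) := by
    refine (avg_mono _ (g := fun _ => _) fun V => ?_).trans_eq (avg_const _ _)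
    refine (hE V x).sum_mul_le (Real.exp_pos _).le fun y hy => ?_
    refine (chainSum_exp_le hK hk hE v x hσ ht htL hstretch hsh m hc y (hsh V x y hy) V).trans ?_
    refine Real.exp_le_exp.2 ?_
    have h1 := hstretch V x y hy
    -- The edge leaving `x` also gains `σ`; it turns the factor `m` of the drift into `m + 1`.
    have h2 : t * (σ * c) ≤ t * ((1 - 1 / K) ^ m * inner ℝ (v y - v x) (direction V)) := by
      have hcm := hc m le_rfl
      have hpow : (0 : ℝ) ≤ (1 - 1 / K) ^ m := by
        refine pow_nonneg ?_ _
        rw [sub_nonneg, div_le_one hK']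
        exact_mod_cast hK
      refine mul_le_mul_of_nonneg_left ?_ ht
      calc σ * c ≤ σ * (1 - 1 / K) ^ m := by gcongr
        _ ≤ _ := by rw [mul_comm]; gcongr
    have h3 : m * (2 * t ^ 2 * L / K) ≤ 2 * t ^ 2 * L := by
      have : (m : ℝ) ≤ K := by exact_mod_cast hmK
      rw [mul_div_assoc', div_le_iff₀ hK', mul_comm]
      gcongr
    linarith
  have b2 : (μ.avg fun V => ∑ y, E V x y * chainSum (correlatedCopy K) E g₂ m y V) ≤
      n * Real.exp (-(θ ^ 2 / (2 * L))) := by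
    refine (avg_chainSum_le (stationary_correlatedCopy hK d k) hE hg₂ m x).trans ?_
    rw [avg_sum]
    calc _ ≤ ∑ _y : Fin n, Real.exp (-(θ ^ 2 / (2 * L))) := by
          refine Finset.sum_le_sum fun y _ => ?_
          by_cases hy : ‖v y - v x‖ ^ 2 ≤ L
          · simpa only [g₂, hy, and_true] using randomMatrix_tail_le hk (v y - v x) hθ hL hy
          · simp only [g₂, hy, and_false, if_false, avg_const]
            positivity
      _ = _ := by simp
  -- At the end of a chain, a projection below `θ` makes `g₁ ≥ 1`, and any other near end has `g₂ =
  -- 1`.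
  have hsplit : ∀ y V, E V x y * chainSum (correlatedCopy K) E (fun _ _ => 1) m y V ≤
      E V x y * chainSum (correlatedCopy K) E g₁ m y V +
        E V x y * chainSum (correlatedCopy K) E g₂ m y V := by
    intro y V
    by_cases hy : E V x y = 0
    · simp [hy]
    rw [← mul_add, ← chainSum_add]
    refine mul_le_mul_of_nonneg_left ?_ (hE0 V x y)
    refine chainSum_mono_of_mem hE0 hsh (fun z W hz => ?_) m y (hsh V x y hy) V
    by_cases hz' : θ ≤ P z W
    · simp only [g₂, hz, hz', and_self, if_true]
      linarith [Real.exp_pos (t * (θ - P z W))]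
    · have : 1 ≤ g₁ z W := Real.one_le_exp (mul_nonneg ht (by linarith))
      linarith [hg₂ z W]
  calc _ ≤ (μ.avg fun V => ∑ y, E V x y * chainSum (correlatedCopy K) E g₁ m y V) +
        μ.avg fun V => ∑ y, E V x y * chainSum (correlatedCopy K) E g₂ m y V := by
        rw [← avg_add]
        refine avg_mono _ fun V => ?_
        rw [← Finset.sum_add_distrib]
        exact Finset.sum_le_sum fun y _ => hsplit y V
    _ ≤ _ := add_le_add b1 b2

end IsMatchingCover

/-! ### Cost and output of the sampler -/

section Sampling

variable {d k : ℕ}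

lemma cost_randomMatrix_le : (randomMatrix d k).cost ≤ d * (k * 2) := by
  rw [randomMatrix, cost_map]
  refine cost_tuple_le _ _ _ fun _ => cost_tuple_le _ _ _ fun _ => ?_
  simp [randomSign, cost]

lemma cost_correlatedCopy_le {K : ℕ} (hK : 1 ≤ K) (U : SignMatrix d k) :
    (correlatedCopy K U).cost ≤ d * (k * (K + 2)) := by
  rw [correlatedCopy, cost_map]
  refine cost_tuple_le _ _ _ fun _ => cost_tuple_le _ _ _ fun _ => ?_
  refine (Nat.add_le_add_left (Finset.sup_le (a := 2) fun i _ => ?_) _).trans (by lia)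
  dsimp only
  split_ifs <;> simp [randomSign, cost]

lemma cost_correlatedTail_le {K : ℕ} (hK : 1 ≤ K) (m : ℕ) (U : SignMatrix d k) :
    (correlatedTail K m U).cost ≤ m * (d * (k * (K + 2))) := by
  induction m generalizing U with
  | zero => simp [correlatedTail, cost]
  | succ m ih =>
    refine (cost_bind_le (always_true _) fun V _ => (cost_map _ _).trans_le (ih V)).trans ?_
    rw [add_mul, one_mul, add_comm]
    gcongr
    exact cost_correlatedCopy_le hK U

lemma cost_correlatedList_le {K : ℕ} (hK : 1 ≤ K) (m : ℕ) :
    (correlatedList d k K (m + 1)).cost ≤ d * (k * 2) + m * (d * (k * (K + 2))) := by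
  refine (cost_bind_le (always_true _) fun V _ =>
    (cost_map _ _).trans_le (cost_correlatedTail_le hK m V)).trans ?_
  gcongr
  exact cost_randomMatrix_le

lemma always_correlatedTail_length (K m : ℕ) (U : SignMatrix d k) :
    (correlatedTail K m U).Always fun l => l.length = m := by
  induction m generalizing U with
  | zero => exact rfl
  | succ m ih => exact (always_true _).bind fun V _ => (ih V).map fun l hl => by simp [hl]

lemma always_correlatedList_length (K m : ℕ) :
    (correlatedList d k K m).Always fun l => l.length = m := by
  cases m with
  | zero => exact rfl
  | succ m =>
    exact (always_true _).bind fun V _ =>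
      (always_correlatedTail_length K m V).map fun l hl => by simp [hl]

lemma always_sample_length {R K : ℕ} (hR : 1 ≤ R) :
    (sample d k R K).Always fun us => us.length ≤ R := by
  refine (always_true _).bind fun us _ => (always_true _).bind fun ws _ =>
    (always_true _).bind fun l _ i => ?_
  have := i.isLt
  simp only [Always, List.length_map, List.length_take]
  lia

lemma cost_sample_le {R : ℕ} (hR : 1 ≤ R) :
    (sample d k R R).cost ≤ 20 * R ^ 2 * (d * k + 1) := by
  obtain ⟨m, rfl⟩ : ∃ m, R = m + 1 := ⟨R - 1, by lia⟩
  have hd : ∀ l : List (SignMatrix d k), (RandProg.draw (m + 1 - 1) fun i =>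
      .ret ((l.take (i.val + 1)).map direction)).cost ≤ m + 1 := fun l => by
    simp [cost]
  have h : (sample d k (m + 1) (m + 1)).cost ≤
      (correlatedList d k (m + 1) (m + 1)).cost + ((correlatedList d k 1 (m + 1)).cost +
        ((m + 1) * (2 * (m + 1) + 1) + (m + 1))) := by
    refine cost_bind_le (always_correlatedList_length _ _) fun us hus =>
      cost_bind_le (always_correlatedList_length _ _) fun ws hws => ?_
    refine (cost_bind_le (always_true _) fun l _ => hd l).trans ?_
    have := cost_shuffle_le us ws
    rw [hus, hws] at this
    gcongr
    nlinarith
  have h1 := cost_correlatedList_le (d := d) (k := k) hR m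
  have h2 := cost_correlatedList_le (d := d) (k := k) le_rfl m
  nlinarith [Nat.zero_le (d * k * m ^ 2), Nat.zero_le (d * k * m), Nat.zero_le (d * k),
    Nat.zero_le (m ^ 2)]

/-- The shuffled list starts with the correlated matrices with probability at least
`(R + 1) ^ (-R)`. -/
lemma le_avg_sample {R K : ℕ} (hR : 1 ≤ R) (F : List (EuclideanSpace ℝ (Fin d)) → ℝ)
    (hF : ∀ us, 0 ≤ F us) :
    (1 / ((R : ℝ) + 1)) ^ R * (1 / R) * ((correlatedList d k K R).avg fun us =>
      ∑ j ∈ Finset.range R, F ((us.take (j + 1)).map direction)) ≤ (sample d k R K).avg F := by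
  obtain ⟨m, rfl⟩ : ∃ m, R = m + 1 := ⟨R - 1, by lia⟩
  simp only [sample, avg_bind, avg_draw, Nat.add_sub_cancel, avg_ret]
  rw [← avg_const_mul]
  refine avg_mono_of_always (always_correlatedList_length _ _) fun us hus => ?_
  rw [← avg_const (correlatedList d k 1 (m + 1)) (_ * _)]
  refine avg_mono_of_always (always_correlatedList_length _ _) fun ws hws => ?_
  have h := le_avg_shuffle us ws
    (fun l => (∑ i : Fin (m + 1), F ((l.take (i.val + 1)).map direction)) / (m + 1))
    fun l => div_nonneg (Finset.sum_nonneg fun i _ => hF _) (by positivity)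
  rw [hus, hws] at h
  refine le_trans (le_of_eq ?_) h
  have e : ∀ i : Fin (m + 1), (us ++ ws).take (i.val + 1) = us.take (i.val + 1) := fun i =>
    List.take_append_of_le_length (by have := i.isLt; lia)
  simp only [e]
  rw [Fin.sum_univ_eq_sum_range (fun i => F ((us.take (i + 1)).map direction)) (m + 1)]
  push_cast
  ring

end Sampling

/-! ### Long edges as marked prefixes of chains -/

section Counting

variable {n d : ℕ}

/-- The indicator of the vertices at squared distance at least `L` from `x`. -/
noncomputable def farIndicator (v : Fin n → EuclideanSpace ℝ (Fin d)) (L : ℝ) (x y : Fin n) : ℝ :=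
  open Classical in if L ≤ ‖v x - v y‖ ^ 2 then 1 else 0

/-- The number of ends, at squared distance at least `L` from `x`, of chains that start at `z`. -/
noncomputable def farCount (v : Fin n → EuclideanSpace ℝ (Fin d))
    (M : EuclideanSpace ℝ (Fin d) → Finset (Fin n × Fin n)) (L : ℝ) (x : Fin n)
    (us : List (EuclideanSpace ℝ (Fin d))) (z : Fin n) : ℝ :=
  open Classical in ∑ y, if ChainEdge M us z y then farIndicator v L x y else 0

variable {v : Fin n → EuclideanSpace ℝ (Fin d)}
  {M : EuclideanSpace ℝ (Fin d) → Finset (Fin n × Fin n)} {L : ℝ}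

lemma farIndicator_eq_zero_or_one (x y : Fin n) :
    farIndicator v L x y = 0 ∨ farIndicator v L x y = 1 := by
  simp only [farIndicator]
  split_ifs <;> simp

lemma longEdgeCount_eq_sum_farCount (us : List (EuclideanSpace ℝ (Fin d))) :
    (longEdgeCount v M L us : ℝ) = ∑ x, farCount v M L x us x := by
  classical
  rw [longEdgeCount, Set.ncard_eq_toFinset_card', Set.toFinset_ofPred, Finset.card_filter]
  push_cast
  rw [Fintype.sum_prod_type]
  refine Finset.sum_congr rfl fun x _ => Finset.sum_congr rfl fun y _ => ?_
  simp only [farIndicator, ite_and]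

lemma farCount_nil (x z : Fin n) : farCount v M L x [] z = farIndicator v L x z := by
  rw [farCount, Finset.sum_eq_single z]
  · simp [ChainEdge]
  · exact fun y _ hy => if_neg fun h => hy h.symm
  · simp

/-- The edge out of `z` is unique, so counting distinct ends is the same as counting chains, and the
count obeys the recursion of `markedSum`. -/
lemma farCount_cons (hM : ∀ u, IsDirectedMatching (M u)) (x : Fin n)
    (u : EuclideanSpace ℝ (Fin d)) (us : List (EuclideanSpace ℝ (Fin d))) (z : Fin n) :
    farCount v M L x (u :: us) z = ∑ y, edgeWeight (M u) z y * farCount v M L x us y := by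
  classical
  rcases ((hM u).isSubsingleIndicator z) with h | ⟨w, hw, h⟩
  · have h' : ∀ y, (z, y) ∉ M u := fun y hy => by
      have := h y
      simp [edgeWeight, hy] at this
    simp [h, farCount, ChainEdge, h']
  · have hw' : (z, w) ∈ M u := by
      by_contra hh
      simp [edgeWeight, hh] at hw
    have h' : ∀ y, (z, y) ∈ M u → y = w := fun y hy => by
      by_contra hne
      have := h y hne
      simp [edgeWeight, hy] at this
    rw [Finset.sum_eq_single w (fun y _ hy => by rw [h y hy, zero_mul]) (by simp), hw, one_mul]
    have hc : ∀ y, ChainEdge M (u :: us) z y ↔ ChainEdge M us w y := fun y =>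
      ⟨fun ⟨z', h1, h2⟩ => h' z' h1 ▸ h2, fun h1 => ⟨w, hw', h1⟩⟩
    simp only [farCount, hc]

lemma sum_farCount_cons (hM : ∀ u, IsDirectedMatching (M u)) {k : ℕ} (x : Fin n)
    (V : SignMatrix d k) (l : List (SignMatrix d k)) (m : ℕ) (z : Fin n) :
    ∑ j ∈ Finset.range (m + 1), farCount v M L x (((V :: l).take (j + 1)).map direction) z =
      ∑ y, edgeWeight (M (direction V)) z y * (farIndicator v L x y +
        ∑ j ∈ Finset.range m, farCount v M L x ((l.take (j + 1)).map direction) y) := by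
  simp only [List.take_succ_cons, List.map_cons, farCount_cons hM]
  rw [Finset.sum_comm]
  refine Finset.sum_congr rfl fun y _ => ?_
  rw [← Finset.mul_sum, Finset.sum_range_succ', List.take_zero, List.map_nil, farCount_nil,
    add_comm]

lemma avg_correlatedTail_farCount (hM : ∀ u, IsDirectedMatching (M u)) {k K : ℕ} (x : Fin n)
    (m : ℕ) (z : Fin n) (U : SignMatrix d k) :
    ((correlatedTail K m U).avg fun l =>
      ∑ j ∈ Finset.range m, farCount v M L x ((l.take (j + 1)).map direction) z) =
      markedSum (correlatedCopy K) (fun V => edgeWeight (M (direction V))) (farIndicator v L x)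
        m z U := by
  induction m generalizing z U with
  | zero => simp [markedSum]
  | succ m ih =>
    simp only [correlatedTail, avg_bind, avg_map, sum_farCount_cons hM, markedSum]
    congr 1
    funext V
    rw [avg_sum]
    refine Finset.sum_congr rfl fun y _ => ?_
    rw [avg_const_mul, avg_add, avg_const, ih]

lemma avg_correlatedList_farCount (hM : ∀ u, IsDirectedMatching (M u)) {k K : ℕ} (x : Fin n)
    (m : ℕ) :
    ((correlatedList d k K (m + 1)).avg fun l =>
      ∑ j ∈ Finset.range (m + 1), farCount v M L x ((l.take (j + 1)).map direction) x) =
      (randomMatrix d k).avg fun V => ∑ y, edgeWeight (M (direction V)) x y *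
        (farIndicator v L x y + markedSum (correlatedCopy K)
          (fun V => edgeWeight (M (direction V))) (farIndicator v L x) m y V) := by
  simp only [correlatedList, avg_bind, avg_map, sum_farCount_cons hM]
  congr 1
  funext V
  rw [avg_sum]
  refine Finset.sum_congr rfl fun y _ => ?_
  rw [avg_const_mul, avg_add, avg_const, avg_correlatedTail_farCount hM]

end Counting

/-! ### Choice of parameters and conclusion -/

lemma one_third_le_one_sub_pow (m i : ℕ) (hi : i ≤ m) :
    (1 / 3 : ℝ) ≤ (1 - 1 / ((m + 1 : ℕ) : ℝ)) ^ i := by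
  rcases Nat.eq_zero_or_pos m with rfl | hm
  · obtain rfl : i = 0 := by lia
    norm_num
  have hm' : (0 : ℝ) < m := by exact_mod_cast hm
  have e : (1 : ℝ) - 1 / ((m + 1 : ℕ) : ℝ) = (1 + 1 / (m : ℝ))⁻¹ := by
    push_cast
    field_simp
    ring
  have h1 : (1 + 1 / (m : ℝ)) ^ i ≤ 3 := by
    calc (1 + 1 / (m : ℝ)) ^ i ≤ (1 + 1 / (m : ℝ)) ^ m :=
          pow_le_pow_right₀ (by have : (0 : ℝ) < 1 / m := by positivity
                                linarith) hi
      _ ≤ Real.exp (1 / m) ^ m := by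
          gcongr
          linarith [Real.add_one_le_exp (1 / (m : ℝ))]
      _ = Real.exp 1 := by
          rw [← Real.exp_nat_mul]
          congr 1
          field_simp
      _ ≤ 3 := by linarith [Real.exp_one_lt_d9]
  rw [e, inv_pow, one_div]
  exact inv_anti₀ (by positivity) h1

lemma IsMatchingCover.le_sum_farCount {n d k m : ℕ} {σ δ L : ℝ}
    {v : Fin n → EuclideanSpace ℝ (Fin d)}
    {M : EuclideanSpace ℝ (Fin d) → Finset (Fin n × Fin n)}
    (h : IsMatchingCover (directionLaw d k) σ δ v M) (hσ : 0 < σ) (hδ0 : 0 < δ) (hδ : δ ≤ 1 / 2)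
    (hk : 1 ≤ k) (hkR : 20 * (Real.log (1 / δ) * ((m + 1 : ℕ) : ℝ) ^ 2) ≤ k) (hn : 2 ≤ n)
    (hR : Real.log (1 / δ) * ((m + 1 : ℕ) : ℝ) ^ 2 ≤ Real.log n)
    (hL : L = σ ^ 2 / 2880 * (((m + 1 : ℕ) : ℝ) ^ 2 / Real.log n)) :
    n * (Real.exp (-(8 * (Real.log (1 / δ) * ((m + 1 : ℕ) : ℝ) ^ 2))) / 2) ≤
      (correlatedList d k (m + 1) (m + 1)).avg fun us => ∑ j ∈ Finset.range (m + 1),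
        (longEdgeCount v M L ((us.take (j + 1)).map direction) : ℝ) := by
  have hn' : (0 : ℝ) < n := by exact_mod_cast (by lia : 0 < n)
  set Λ := Real.log (1 / δ) with hΛ
  set R : ℝ := ((m + 1 : ℕ) : ℝ) with hRdef
  have hR1 : 1 ≤ R := by simp [hRdef]
  have hδΛ : δ = Real.exp (-Λ) := by
    rw [hΛ, one_div, Real.log_inv, neg_neg, Real.exp_log hδ0]
  have hΛ2 : Real.log 2 ≤ Λ := by
    refine Real.log_le_log two_pos ?_
    rw [le_div_iff₀ hδ0]
    linarith
  have hΛ0 : 0 < Λ := (Real.log_pos one_lt_two).trans_le hΛ2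
  have hlog : 0 < Real.log n := by
    have : 0 < Λ * R ^ 2 := by positivity
    linarith
  have hL0 : 0 < L := by rw [hL]; positivity
  set Y := Λ * R ^ 2 with hY
  have hYΛ : Λ ≤ Y := le_mul_of_one_le_right hΛ0.le (one_le_pow₀ hR1)
  set E : SignMatrix d k → Fin n → Fin n → ℝ := fun V => edgeWeight (M (direction V))
  have hE : ∀ V x, IsSubsingleIndicator (E V x) := fun V x => (h.matching _).isSubsingleIndicator x
  set κ : SignMatrix d k → RandProg (SignMatrix d k) := correlatedCopy (m + 1)
  -- the chains that survive
  have hsurv := h.le_sum_avg_chainSum hδ0 (by linarith) (Nat.le_add_left 1 m) m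
  have hsurv2 : n * Real.exp (-(8 * Y)) ≤
      (δ / 4) ^ (2 * (m + 1) * (m + 1)) * (δ / 2 * n) := by
    have e1 : Real.exp (-(8 * Y)) = δ ^ (8 * (m + 1) ^ 2) := by
      rw [hδΛ, ← Real.exp_nat_mul]
      congr 1
      simp only [hY, hRdef]
      push_cast
      ring
    -- From `δ ≤ 1/2`: `δ³ ≤ δ/4` and `δ² ≤ δ/2`, with total exponent `6R² + 2 ≤ 8R²`.
    have e2 : δ ^ (8 * (m + 1) ^ 2) ≤ (δ / 4) ^ (2 * (m + 1) * (m + 1)) * (δ / 2) := by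
      calc δ ^ (8 * (m + 1) ^ 2) ≤ δ ^ (3 * (2 * (m + 1) * (m + 1)) + 2) :=
            pow_le_pow_of_le_one hδ0.le (by linarith) (by nlinarith)
        _ = (δ ^ 3) ^ (2 * (m + 1) * (m + 1)) * δ ^ 2 := by rw [pow_add, pow_mul]
        _ ≤ _ := by
          gcongr
          · nlinarith [mul_le_mul hδ hδ hδ0.le (by norm_num)]
          · nlinarith
    rw [e1]
    calc (n : ℝ) * δ ^ (8 * (m + 1) ^ 2)
        ≤ n * ((δ / 4) ^ (2 * (m + 1) * (m + 1)) * (δ / 2)) := by gcongr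
      _ = _ := by ring
  -- the chains that stay near their starting point
  set t : ℝ := 120 * Λ * R / σ with ht
  have hσL : Λ * L ≤ σ ^ 2 / 2880 := by
    rw [hL, ← mul_assoc, mul_comm Λ, mul_assoc, mul_div_assoc']
    exact mul_le_of_le_one_right (by positivity) ((div_le_one hlog).2 hR)
  have htL : t ^ 2 * L ≤ 5 * Y := by
    have : t ^ 2 * L = 14400 * Λ * R ^ 2 / σ ^ 2 * (Λ * L) := by rw [ht]; field_simp; ring
    rw [this]
    calc _ ≤ 14400 * Λ * R ^ 2 / σ ^ 2 * (σ ^ 2 / 2880) := by gcongr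
      _ = 5 * Y := by rw [hY]; field_simp; norm_num
  have hshort : ∀ x, ((randomMatrix d k).avg fun V => ∑ y, E V x y * (1 - farIndicator v L x y) *
      chainSum κ (fun V z y => E V z y * (1 - farIndicator v L x y)) (fun _ _ => 1) m y V) ≤
      2 * Real.exp (-(10 * Y)) := by
    intro x
    have hb := h.avg_short_chainSum_le (K := m + 1) (m := m) (t := t) (L := L) (c := 1 / 3)
      (θ := R * σ / 6) hσ.le (Nat.le_add_left 1 m) hk (Nat.le_succ m) (by positivity) hL0
      (by positivity) (by linarith) (one_third_le_one_sub_pow m) x (farIndicator v L x)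
      (farIndicator_eq_zero_or_one x) (fun y hy => by
        rw [norm_sub_rev]
        by_contra hh
        simp [farIndicator, (not_le.1 hh).le] at hy)
    refine hb.trans ?_
    rw [two_mul (Real.exp _)]
    refine add_le_add (Real.exp_le_exp.2 ?_) ?_
    · have e1 : t * (R * σ / 6) - (m + 1) * (t * σ * (1 / 3)) = -(20 * Y) := by
        have : (m : ℝ) + 1 = R := by rw [hRdef]; push_cast; ring
        rw [this, ht, hY]
        field_simp
        ring
      rw [e1]
      linarith
    -- The constant in `L` makes the tail `n^(-40)`, which beats the union bound over `n` ends since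
    -- `Y ≤ log n`.
    · have e2 : (R * σ / 6) ^ 2 / (2 * L) = 40 * Real.log n := by
        rw [hL]
        field_simp
        norm_num
      rw [e2]
      nth_rewrite 1 [← Real.exp_log hn']
      rw [← Real.exp_add]
      refine Real.exp_le_exp.2 ?_
      linarith
  have hexp : 4 * Real.exp (-(10 * Y)) ≤ Real.exp (-(8 * Y)) := by
    have h4 : (4 : ℝ) = Real.exp (2 * Real.log 2) := by
      rw [mul_comm, Real.exp_mul, Real.exp_log two_pos]
      norm_num
    rw [h4, ← Real.exp_add]
    refine Real.exp_le_exp.2 ?_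
    linarith
  have hfar : ((correlatedList d k (m + 1) (m + 1)).avg fun us => ∑ j ∈ Finset.range (m + 1),
      (longEdgeCount v M L ((us.take (j + 1)).map direction) : ℝ)) =
      ∑ x, (randomMatrix d k).avg fun V => ∑ y, E V x y *
        (farIndicator v L x y + markedSum κ E (farIndicator v L x) m y V) := by
    simp only [longEdgeCount_eq_sum_farCount]
    rw [← Finset.sum_congr rfl fun x _ => avg_correlatedList_farCount h.matching x m, ← avg_sum]
    congr 1
    funext us
    exact Finset.sum_comm
  rw [hfar]
  have hsplit : ∀ x, ((randomMatrix d k).avg fun V => ∑ y, E V x y *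
      chainSum κ E (fun _ _ => 1) m y V) ≤ ((randomMatrix d k).avg fun V => ∑ y, E V x y *
        (farIndicator v L x y + markedSum κ E (farIndicator v L x) m y V)) +
        2 * Real.exp (-(10 * Y)) := by
    intro x
    refine le_trans ?_ (add_le_add_right (hshort x) _)
    rw [← avg_add]
    refine avg_mono _ fun V => ?_
    rw [← Finset.sum_add_distrib]
    exact Finset.sum_le_sum fun y _ =>
      chainSum_mul_le_marked hE (farIndicator_eq_zero_or_one x) m V x y
  have htot := Finset.sum_le_sum fun x (_ : x ∈ Finset.univ) => hsplit x
  rw [Finset.sum_add_distrib, Finset.sum_const, Finset.card_univ, Fintype.card_fin,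
    nsmul_eq_mul] at htot
  have := mul_le_mul_of_nonneg_left hexp hn'.le
  linarith

theorem mainTheorem7 :
    ∃ A B : ℝ, 0 < A ∧ 0 < B ∧
      ∀ σ δ : ℝ, 0 < σ → 0 < δ → δ < 1 →
        ∃ a b C : ℝ, 0 < a ∧ 0 < b ∧ 0 < C ∧
          ∀ n R : ℕ, 1 ≤ R → (R : ℝ) ≤ a * √(Real.log n) →
            ∃ (L : ℝ) (k₀ R' K : ℕ),
              b * ((R : ℝ) ^ 2 / Real.log n) ≤ L ∧
              (k₀ : ℝ) ≤ A * ((R : ℝ) ^ 2 * Real.log (1 / δ)) ∧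
              (k₀ : ℝ) ≤ B * Real.log n ∧
              1 ≤ R' ∧ R' ≤ R ∧ 1 ≤ K ∧ K ≤ R ∧
              ∀ d k : ℕ, 1 ≤ k → k₀ ≤ k →
                (∀ us ∈ (sample d k R' K).law.support, us.length ≤ R) ∧
                (sample d k R' K).cost ≤ 20 * R ^ 2 * (d * k + 1) ∧
                ∀ (v : Fin n → EuclideanSpace ℝ (Fin d))
                  (M : EuclideanSpace ℝ (Fin d) → Finset (Fin n × Fin n)),
                  IsMatchingCover (directionLaw d k) σ δ v M →
                  ENNReal.ofReal (Real.exp (-(C * (R : ℝ) ^ 2)) * n) ≤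
                    expectation (sample d k R' K).law
                      (fun us => (longEdgeCount v M L us : ℝ≥0∞)) := by
  refine ⟨40, 40, by norm_num, by norm_num, fun σ δ hσ hδ0 hδ1 => ?_⟩
  have hΛ0 : 0 < Real.log (1 / δ) := Real.log_pos (by rw [lt_div_iff₀ hδ0]; linarith)
  set Λ := Real.log (1 / δ) with hΛ
  -- The choice of `a` is equivalent to `Y ≤ log n`. In `C`, the `8 * Λ` pays for survival and the
  -- `3` for the sampler's two losses and a factor `1/2`.
  refine ⟨1 / √Λ, σ ^ 2 / 2880, 8 * Λ + 3, by positivity, by positivity, by positivity,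
    fun n R hR hRn => ?_⟩
  have hR' : (1 : ℝ) ≤ R := by exact_mod_cast hR
  have hlog : 0 < Real.log n := by
    by_contra hh
    rw [Real.sqrt_eq_zero_of_nonpos (not_lt.1 hh)] at hRn
    linarith
  have hn : 2 ≤ n := by
    by_contra hh
    interval_cases n <;> simp at hlog
  have hY : Λ * (R : ℝ) ^ 2 ≤ Real.log n := by
    have := pow_le_pow_left₀ (by positivity) hRn 2
    rw [mul_pow, div_pow, Real.sq_sqrt hΛ0.le, Real.sq_sqrt hlog.le, one_pow, one_div_mul_eq_div,
      le_div_iff₀ hΛ0] at this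
    linarith
  have hk₀ : (⌊40 * (Λ * (R : ℝ) ^ 2)⌋₊ : ℝ) ≤ 40 * (Λ * (R : ℝ) ^ 2) :=
    Nat.floor_le (by positivity)
  refine ⟨σ ^ 2 / 2880 * ((R : ℝ) ^ 2 / Real.log n), ⌊40 * (Λ * (R : ℝ) ^ 2)⌋₊, R, R, le_rfl,
    by linarith, by linarith, hR, le_rfl, hR, le_rfl, fun d k hk hkk => ⟨fun us hus =>
      always_of_mem_support (always_sample_length hR) hus, cost_sample_le hR, fun v M h => ?_⟩⟩
  have hδ := h.le_half (by lia)
  -- Taking the floor of `40Y` keeps `k₀` below its upper bounds even when `Y` is small. Since `k ≥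
  -- 1` and `k ≥ k₀`, still `2k ≥ k₀ + 1 > 40Y`.
  have hk' : 20 * (Λ * (R : ℝ) ^ 2) ≤ k := by
    have h1 := Nat.lt_floor_add_one (40 * (Λ * (R : ℝ) ^ 2))
    have h2 : (⌊40 * (Λ * (R : ℝ) ^ 2)⌋₊ : ℝ) ≤ k := by exact_mod_cast hkk
    have h3 : (1 : ℝ) ≤ k := by exact_mod_cast hk
    linarith
  have hexp := (sample d k R R).expectation_law
    (fun us => (longEdgeCount v M (σ ^ 2 / 2880 * ((R : ℝ) ^ 2 / Real.log n)) us : ℝ))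
    fun us => Nat.cast_nonneg _
  simp only [ENNReal.ofReal_natCast] at hexp
  rw [hexp]
  refine ENNReal.ofReal_le_ofReal ?_
  refine le_trans ?_ (le_avg_sample hR _ fun us => Nat.cast_nonneg _)
  obtain ⟨m, rfl⟩ : ∃ m, R = m + 1 := ⟨R - 1, by lia⟩
  have key := h.le_sum_farCount hσ hδ0 hδ hk hk' hn hY rfl
  refine le_trans ?_ (mul_le_mul_of_nonneg_left key (by positivity))
  set r : ℝ := ((m + 1 : ℕ) : ℝ)
  have hr : r ≤ r ^ 2 := by nlinarith
  have b1 : Real.exp (-r ^ 2) ≤ (1 / (r + 1)) ^ (m + 1) := by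
    have e : Real.exp (-r ^ 2) = (1 / Real.exp r) ^ (m + 1) := by
      rw [one_div, ← Real.exp_neg, ← Real.exp_nat_mul]
      congr 1
      simp only [r]
      ring
    rw [e]
    gcongr
    exact Real.add_one_le_exp r
  have b2 : Real.exp (-r ^ 2) ≤ 1 / r := by
    rw [Real.exp_neg, ← one_div]
    gcongr
    linarith [Real.add_one_le_exp (r ^ 2)]
  have b3 : Real.exp (-r ^ 2) ≤ 1 / 2 := by
    rw [Real.exp_neg, ← one_div]
    gcongr
    linarith [Real.add_one_le_exp (r ^ 2)]
  calc Real.exp (-((8 * Λ + 3) * r ^ 2)) * n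
      = Real.exp (-r ^ 2) * Real.exp (-r ^ 2) *
          (n * (Real.exp (-(8 * (Λ * r ^ 2))) * Real.exp (-r ^ 2))) := by
        rw [show -((8 * Λ + 3) * r ^ 2) =
          -r ^ 2 + -r ^ 2 + (-(8 * (Λ * r ^ 2)) + -r ^ 2) by ring, Real.exp_add, Real.exp_add,
          Real.exp_add]
        ring
    _ ≤ (1 / (r + 1)) ^ (m + 1) * (1 / r) * (n * (Real.exp (-(8 * (Λ * r ^ 2))) * (1 / 2))) := by
        gcongr
    _ = _ := by ring
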